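/- Conventions. A finite simplicial complex $K$ is a finite family of finite sets (faces) closed under taking subsets; its vertices are the $v$ with $\{v\}\in K$, $\dim\sigma=|\sigma|-1$ and $\dim K=\max_{\sigma\in K}\dim\sigma$. For $\sigma\in K$ let $\mathrm{lk}_K(\sigma)=\{\tau\in K:\sigma\cap\tau=\emptyset,\ \sigma\cup\tau\in K\}$; let $K*L=\{\sigma\cup\tau:\sigma\in K,\tau\in L\}$ and $\partial F=2^F\setminus\{F\}$. A missing face of $K$ is a set $M\notin K$ all of whose proper subsets are faces of $K$. With $n=\dim K+1$ and $f_{j-1}$ the number of faces with $j$ elements, $h(K,t)=\sum_{m=0}^n h_mt^m$ where $h_m=\sum_{j=0}^m(-1)^{m-j}\binom{n-j}{m-j}f_{j-1}$. Fix an integral domain $R$ of coefficients (for example $\mathbb Z$ or a field). A $(d-1)$-dimensional complex $K$ is a homology sphere if for every face $\sigma$ (including $\emptyset$) the reduced simplicial homology of $\mathrm{lk}_K(\sigma)$ over $R$ is $R$ in dimension $d-1-|\sigma|$ and $0$ in all other dimensions. For $i\ge 1$, $d\ge 0$, let $\mathcal{HS}(i,d)$ be the family of $(d-1)$-dimensional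 homology spheres without missing faces of dimension $>i$. For $d\ge1$ let $P_{d,i}(t)=(1+t+\dots+t^i)^q(1+t+\dots+t^r)$, where $d=qi+r$ with $q\ge0$ and $1\le r\le i$, and let $P_{0,i}=1$. The polynomials $t^jP_{d-2j,i}(t)$, $0\le j\le\lfloor d/2\rfloor$, are linearly independent; for $\Delta\in\mathcal{HS}(i,d)$ let $g^{(i)}(\Delta)$ be the vector of coefficients of $h(\Delta,t)$ with respect to them. Theorem. Let $i,d\ge1$, let $\Delta\in\mathcal{HS}(i,d)$, let $F$ be a nonempty face of $\Delta$ of dimension $\le i$, let $v_F$ be a point that is not a vertex of $\Delta$, and let $$\Delta(F)=(\Delta\setminus\{T\in\Delta:F\subseteq T\})\ \cup\ \{\emptyset,\{v_F\}\}*\partial F*\mathrm{lk}_\Delta(F)$$ be the stellar subdivision of $\Delta$ at $F$. Then $\mathrm{lk}_\Delta(F)\in\mathcal{HS}(i,d-|F|)$ and $\Delta(F)\in\mathcal{HS}(i,d)$; the vectors $g^{(i)}(\Delta)$, $g^{(i)}(\mathrm{lk}_\Delta(F))$ and $g^{(i)}(\Delta(F))$ are defined (the three $h$-polynomials are integer combinations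 of the respective families above); and if $g^{(i)}(\Delta)\ge0$ and $g^{(i)}(\mathrm{lk}_\Delta(F))\ge0$ (componentwise), then $g^{(i)}(\Delta(F))\ge0$. -/

import Mathlib

open Finset Polynomial

noncomputable section

/-- A finite abstract simplicial complex with vertices in `V`: a finite family of finite sets
closed under taking subsets. The empty set is a face as soon as there is any face; the void family
is allowed because the boundary complex of the empty simplex is void. The vertices of the complex
are the `v` with `{v}` a face. -/
@[ext]
structure SimpComplex (V : Type*) where
  faces : Finset (Finset V)
  down_closed : ∀ σ ∈ faces, ∀ τ, τ ⊆ σ → τ ∈ faces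

namespace SimpComplex

section Combinatorics

variable {V : Type*} [DecidableEq V]

instance : Membership (Finset V) (SimpComplex V) := ⟨fun K σ => σ ∈ K.faces⟩

/-- The link `{τ ∈ K : σ ∩ τ = ∅, σ ∪ τ ∈ K}`. -/
def link (K : SimpComplex V) (σ : Finset V) : SimpComplex V where
  faces := {τ ∈ K.faces | Disjoint σ τ ∧ σ ∪ τ ∈ K.faces}
  down_closed := by
    intro τ hτ ρ hρ
    rw [Finset.mem_filter] at hτ ⊢
    exact ⟨K.down_closed τ hτ.1 ρ hρ, hτ.2.1.mono_right hρ,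
      K.down_closed _ hτ.2.2 _ (Finset.union_subset_union_right hρ)⟩

/-- The join `{σ ∪ τ : σ ∈ K, τ ∈ L}`. -/
def join (K L : SimpComplex V) : SimpComplex V where
  faces := Finset.image₂ (· ∪ ·) K.faces L.faces
  down_closed := by
    intro ρ hρ π hπ
    rw [Finset.mem_image₂] at hρ ⊢
    obtain ⟨σ, hσ, τ, hτ, rfl⟩ := hρ
    refine ⟨π ∩ σ, K.down_closed σ hσ _ Finset.inter_subset_right,
      π ∩ τ, L.down_closed τ hτ _ Finset.inter_subset_right, ?_⟩
    rw [← Finset.inter_union_distrib_left]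
    exact Finset.inter_eq_left.2 hπ

/-- The complex `{∅, {v}}` with a single vertex. -/
def point (v : V) : SimpComplex V where
  faces := ({v} : Finset V).powerset
  down_closed := fun _ hσ _ hτ =>
    Finset.mem_powerset.2 (hτ.trans (Finset.mem_powerset.1 hσ))

/-- The boundary complex `2^F \ {F}`. -/
def boundaryComplex (F : Finset V) : SimpComplex V where
  faces := F.ssubsets
  down_closed := fun _ hσ _ hτ =>
    Finset.mem_ssubsets.2 (lt_of_le_of_lt hτ (Finset.mem_ssubsets.1 hσ))

/-- The stellar subdivision of `K` at `F` with new vertex `v`: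
`(K \ {T ∈ K : F ⊆ T}) ∪ {v} * ∂F * lk_K(F)`. -/
def stellar (K : SimpComplex V) (F : Finset V) (v : V) : SimpComplex V where
  faces := {T ∈ K.faces | ¬ F ⊆ T} ∪
    (join (point v) (join (boundaryComplex F) (K.link F))).faces
  down_closed := by
    intro σ hσ τ hτ
    rw [Finset.mem_union] at hσ ⊢
    rcases hσ with hσ | hσ
    · rw [Finset.mem_filter] at hσ
      exact Or.inl (Finset.mem_filter.2
        ⟨K.down_closed σ hσ.1 τ hτ, fun h => hσ.2 (h.trans hτ)⟩)
    · exact Or.inr (SimpComplex.down_closed _ σ hσ τ hτ)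

/-- `M` is a missing face of `K`: it is not a face, but all its proper subsets are. -/
def IsMissingFace (K : SimpComplex V) (M : Finset V) : Prop :=
  M ∉ K ∧ ∀ τ, τ ⊂ M → τ ∈ K

/-- `dim K + 1`, the largest cardinality of a face. -/
def size (K : SimpComplex V) : ℕ := K.faces.sup Finset.card

/-- The number `f_{j-1}(K)` of faces with `j` elements. -/
def fNum (K : SimpComplex V) (j : ℕ) : ℕ := #{σ ∈ K.faces | #σ = j}

/-- The `h`-numbers `h_m = ∑_{j ≤ m} (-1)^{m-j} C(n-j, m-j) f_{j-1}`, where `n = dim K + 1`. -/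
def hNum (K : SimpComplex V) (m : ℕ) : ℤ :=
  ∑ j ∈ Finset.range (m + 1),
    (-1) ^ (m - j) * ((K.size - j).choose (m - j) : ℤ) * (K.fNum j : ℤ)

/-- The `h`-polynomial. -/
def hPoly (K : SimpComplex V) : ℤ[X] :=
  ∑ m ∈ Finset.range (K.size + 1), C (K.hNum m) * X ^ m

end Combinatorics

section Homology

variable {V : Type*} [LinearOrder V] (R : Type*) [CommRing R]

/-- The augmented simplicial boundary map on formal combinations of finite sets of vertices,
`∂ {v_0 < ... < v_n} = ∑_k (-1)^k {v_0, ..., v_n} \ {v_k}`, including `∂ {v} = ∅` and `∂ ∅ = 0`. -/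
def boundaryMap : (Finset V →₀ R) →ₗ[R] (Finset V →₀ R) :=
  Finsupp.linearCombination R fun σ : Finset V =>
    ∑ v ∈ σ, Finsupp.single (σ.erase v) ((-1 : R) ^ #{w ∈ σ | w < v})

/-- The chains of `K` on faces with `m` elements, that is, of dimension `m - 1`. -/
def chains (K : SimpComplex V) (m : ℕ) : Submodule R (Finset V →₀ R) :=
  Finsupp.supported R R {σ | σ ∈ K ∧ #σ = m}

/-- The `(m-1)`-cycles of the augmented chain complex of `K`. -/
def cycles (K : SimpComplex V) (m : ℕ) : Submodule R (Finset V →₀ R) :=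
  K.chains R m ⊓ LinearMap.ker (boundaryMap R)

/-- The `(m-1)`-boundaries of the augmented chain complex of `K`. -/
def boundaries (K : SimpComplex V) (m : ℕ) : Submodule R (Finset V →₀ R) :=
  (K.chains R (m + 1)).map (boundaryMap R)

/-- The reduced simplicial homology of `K` in dimension `m - 1` with coefficients in `R`: cycles
modulo boundaries, as the image of the cycles in the quotient of all chains by the boundaries. -/
def reducedHomology (K : SimpComplex V) (m : ℕ) :
    Submodule R ((Finset V →₀ R) ⧸ K.boundaries R m) :=
  (K.cycles R m).map (K.boundaries R m).mkQ

/-- `K` is a `(d-1)`-dimensional homology sphere over `R`: it has dimension `d - 1`, and the link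
of every face `σ` (including `σ = ∅`) has the reduced homology of a sphere of dimension
`d - 1 - |σ|`. -/
def IsHomologySphere (K : SimpComplex V) (d : ℕ) : Prop :=
  K.faces.Nonempty ∧ K.size = d ∧ ∀ σ ∈ K, ∀ m : ℕ,
    (m + #σ = d → Nonempty ((K.link σ).reducedHomology R m ≃ₗ[R] R)) ∧
    (m + #σ ≠ d → Subsingleton ((K.link σ).reducedHomology R m))

/-- The family `HS(i,d)`: homology spheres over `R` of dimension `d - 1` without missing faces of
dimension larger than `i`. -/
def IsHS (i d : ℕ) (K : SimpComplex V) : Prop :=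
  K.IsHomologySphere R d ∧ ∀ M, K.IsMissingFace M → #M ≤ i + 1

end Homology

end SimpComplex

/-- The polynomial `1 + t + ... + t^n`. -/
def geomPoly (n : ℕ) : ℤ[X] := ∑ k ∈ Finset.range (n + 1), X ^ k

/-- `P_{d,i} = (1 + ... + t^i)^q (1 + ... + t^r)` where `d = q i + r` with `q ≥ 0`, `1 ≤ r ≤ i`
(so `q = (d-1) / i` and `r = (d-1) % i + 1`) if `d ≥ 1`; and `P_{0,i} = 1`. -/
def gP (d i : ℕ) : ℤ[X] :=
  if d = 0 then 1 else geomPoly i ^ ((d - 1) / i) * geomPoly ((d - 1) % i + 1)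

/-- The family `B_{d,i} = (t^j P_{d-2j,i})`, `0 ≤ j ≤ ⌊d/2⌋`. -/
def gBasis (i d : ℕ) (j : Fin (d / 2 + 1)) : ℤ[X] := X ^ (j : ℕ) * gP (d - 2 * j) i

theorem geomPoly_coeff_zero (n : ℕ) : (geomPoly n).coeff 0 = 1 := by
  simp [geomPoly, Polynomial.coeff_X_pow]

theorem gP_coeff_zero (d i : ℕ) : (gP d i).coeff 0 = 1 := by
  unfold gP
  split_ifs
  · simp
  · rw [Polynomial.mul_coeff_zero, Polynomial.coeff_zero_eq_eval_zero (geomPoly i ^ _),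
      Polynomial.eval_pow, ← Polynomial.coeff_zero_eq_eval_zero, geomPoly_coeff_zero,
      geomPoly_coeff_zero]
    simp

theorem linearIndependent_gBasis (i d : ℕ) : LinearIndependent ℤ (gBasis i d) := by
  rw [Fintype.linearIndependent_iff]
  intro c hc
  have key : ∀ n : ℕ, ∀ j : Fin (d / 2 + 1), (j : ℕ) = n → c j = 0 := by
    intro n
    induction n using Nat.strong_induction_on with
    | _ n ih =>
      intro j hj
      have h := congrArg (fun p : ℤ[X] => p.coeff n) hc
      simp only [Polynomial.finsetSum_coeff, Polynomial.coeff_zero, Polynomial.coeff_smul,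
        smul_eq_mul, gBasis] at h
      rw [Finset.sum_eq_single j] at h
      · subst hj
        simpa [Polynomial.coeff_X_pow_mul', gP_coeff_zero] using h
      · intro k _ hk
        have hkn : (k : ℕ) ≠ n := fun e => hk (Fin.ext (e.trans hj.symm))
        rcases lt_or_gt_of_ne hkn with h1 | h1
        · rw [ih k h1 k rfl, zero_mul]
        · rw [Polynomial.coeff_X_pow_mul', if_neg (by omega), mul_zero]
      · simp
  exact fun j => key j j rfl

/-- `p` can be expressed in the basis `B_{d,i}`. -/
def InGSpan (i d : ℕ) (p : ℤ[X]) : Prop := p ∈ Submodule.span ℤ (Set.range (gBasis i d))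

open Classical in
/-- The vector `g^{(d,i)}(p)` of coefficients of `p` in the basis `B_{d,i}` (with the value `0` if
`p` cannot be expressed in it). -/
def gVector (i d : ℕ) (p : ℤ[X]) : Fin (d / 2 + 1) → ℤ :=
  if hp : InGSpan i d p then ⇑((linearIndependent_gBasis i d).repr ⟨p, hp⟩) else 0

end

/-! The inequality comes from h(Δ(F)) = h(Δ) + (t + ... + t^{|F|-1}) h(lk F). The faces containing F
contribute t^{|F|} h(lk F). They are replaced by v * ∂F * lk F, which contributes t (1 + ... +
t^{|F|-1}) h(lk F) (`hPoly_stellar_add`). For |F| ≥ 2 the factor is t times `geomPoly (|F| - 2)`,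
and |F| - 2 < i. It therefore suffices that for a ≤ i multiplication by `geomPoly a` preserves
non-negative combinations, raising the degree by a (`InGCone.geomPoly_mul`). For two geometric
factors, degree is moved from the shorter to the longer one until the longer reaches i or the
shorter is used up; each move leaves a non-negative remainder (`geomPoly_mul_geomPoly_succ`).

The g-vectors exist because every palindromic integer polynomial lies in the span
(`inGSpan_of_isPalindromic`), and h is palindromic by the Dehn-Sommerville relations, which need
only the Euler characteristics of all links.

That Δ(F) is a homology sphere is checked link by link. A link in Δ(F) is an old link, a stellar
subdivision of an old link, or a join ∂G * L with L an old link. Subdivision preserves homology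
(`nonempty_reducedHomology_stellar_equiv`), and joining with ∂G is an iterated suspension
(`HasSphereHomology.join_boundaryComplex`). Missing faces of the link and of Δ(F) are bounded by
enlarging them to missing faces of Δ, except that F itself may become missing; this is where |F| ≤ i
+ 1 enters. -/

noncomputable section

/-! ### Non-negative combinations of the polynomials `t^j P_{d-2j,i}` -/

/-- `p` is a combination of the family `gBasis i d` with non-negative integer coefficients. -/
def InGCone (i d : ℕ) (p : ℤ[X]) : Prop :=
  ∃ c : Fin (d / 2 + 1) → ℤ, 0 ≤ c ∧ p = ∑ j, c j • gBasis i d j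

/-- Coordinates in a linearly independent family are unique. This replaces coordinate vectors by a
cone with convenient closure properties. -/
theorem inGCone_iff {i d : ℕ} {p : ℤ[X]} (hp : InGSpan i d p) :
    InGCone i d p ↔ 0 ≤ gVector i d p := by
  unfold gVector
  rw [dif_pos hp]
  constructor
  · rintro ⟨c, hc, rfl⟩
    have h : (linearIndependent_gBasis i d).repr ⟨∑ j, c j • gBasis i d j, hp⟩
        = Finsupp.equivFunOnFinite.symm c := by
      rw [LinearIndependent.repr_eq]
      rw [Finsupp.linearCombination_apply, Finsupp.sum_fintype _ _ (by simp)]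
      rfl
    rw [h]
    exact hc
  · intro h
    refine ⟨_, h, ?_⟩
    have h' := (linearIndependent_gBasis i d).linearCombination_repr ⟨p, hp⟩
    rw [Finsupp.linearCombination_apply, Finsupp.sum_fintype _ _ (by simp)] at h'
    exact h'.symm

theorem InGCone.inGSpan {i d : ℕ} {p : ℤ[X]} (hp : InGCone i d p) : InGSpan i d p := by
  obtain ⟨c, -, rfl⟩ := hp
  exact Submodule.sum_mem _ fun j _ => Submodule.smul_mem _ _ (Submodule.subset_span ⟨j, rfl⟩)

theorem InGCone.zero (i d : ℕ) : InGCone i d 0 := ⟨0, le_rfl, by simp⟩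

theorem InGCone.add {i d : ℕ} {p q : ℤ[X]} (hp : InGCone i d p) (hq : InGCone i d q) :
    InGCone i d (p + q) := by
  obtain ⟨c, hc, rfl⟩ := hp
  obtain ⟨e, he, rfl⟩ := hq
  exact ⟨c + e, add_nonneg hc he, by simp [add_smul, Finset.sum_add_distrib]⟩

theorem InGCone.smul {i d : ℕ} {p : ℤ[X]} (hp : InGCone i d p) {a : ℤ} (ha : 0 ≤ a) :
    InGCone i d (a • p) := by
  obtain ⟨c, hc, rfl⟩ := hp
  exact ⟨a • c, smul_nonneg ha hc, by simp [Finset.smul_sum, mul_smul]⟩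

theorem InGCone.sum {ι : Type*} {i d : ℕ} (s : Finset ι) (f : ι → ℤ[X])
    (h : ∀ j ∈ s, InGCone i d (f j)) : InGCone i d (∑ j ∈ s, f j) := by
  classical
  induction s using Finset.induction_on with
  | empty => simpa using InGCone.zero i d
  | insert a s ha ih =>
    rw [Finset.sum_insert ha]
    exact (h a (by simp)).add (ih fun j hj => h j (by simp [hj]))

theorem InGCone.X_pow_mul_gP {i d e j : ℕ} (h : e + 2 * j = d) :
    InGCone i d (X ^ j * gP e i) := by
  have hj : j < d / 2 + 1 := by omega
  refine ⟨Pi.single ⟨j, hj⟩ 1, Pi.single_nonneg.2 zero_le_one, ?_⟩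
  rw [Finset.sum_eq_single ⟨j, hj⟩]
  · simp [gBasis, ← h]
  · intro b _ hb
    simp [hb]
  · simp

theorem InGCone.X_pow_mul {i d e j : ℕ} {p : ℤ[X]} (h : e + 2 * j = d) (hp : InGCone i e p) :
    InGCone i d (X ^ j * p) := by
  obtain ⟨c, hc, rfl⟩ := hp
  rw [Finset.mul_sum]
  refine InGCone.sum _ _ fun k _ => ?_
  rw [mul_smul_comm]
  refine InGCone.smul ?_ (hc k)
  rw [gBasis, ← mul_assoc, ← pow_add]
  exact InGCone.X_pow_mul_gP (by have := k.2; omega)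

/-! ### Products of geometric polynomials -/

/-- The definition uses remainders 1, ..., i. Remainder 0 may also be used, since `geomPoly 0 = 1`:
quotient q + 1 with remainder 0 and quotient q with remainder i give the same product. -/
theorem gP_mul_add {i : ℕ} (hi : 1 ≤ i) (q s : ℕ) (hs : s ≤ i) :
    gP (q * i + s) i = geomPoly i ^ q * geomPoly s := by
  have h0 : geomPoly 0 = 1 := by simp [geomPoly]
  rcases Nat.eq_zero_or_pos s with rfl | hs0
  · rcases Nat.eq_zero_or_pos q with rfl | hq
    · simp [gP, h0]
    · obtain ⟨q, rfl⟩ : ∃ q', q = q' + 1 := ⟨q - 1, by omega⟩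
      have e : (q + 1) * i + 0 - 1 = (i - 1) + i * q := by
        obtain ⟨i, rfl⟩ : ∃ q', i = q' + 1 := ⟨i - 1, by omega⟩
        rw [add_zero, Nat.add_sub_cancel, add_mul, one_mul, mul_comm q]
        omega
      have hne : (q + 1) * i + 0 ≠ 0 := by positivity
      rw [gP, if_neg hne, e, Nat.add_mul_div_left _ _ (by omega), Nat.add_mul_mod_self_left,
        Nat.div_eq_of_lt (by omega), Nat.mod_eq_of_lt (by omega), h0, zero_add,
        Nat.sub_add_cancel hi, pow_succ, mul_one]
  · have e : q * i + s - 1 = (s - 1) + i * q := by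
      rw [mul_comm]; omega
    rw [gP, if_neg (by omega), e, Nat.add_mul_div_left _ _ (by omega), Nat.add_mul_mod_self_left,
      Nat.div_eq_of_lt (by omega), Nat.mod_eq_of_lt (by omega), zero_add, Nat.sub_add_cancel hs0]

theorem X_sub_one_mul_geomPoly (n : ℕ) : (X - 1) * geomPoly n = X ^ (n + 1) - 1 := by
  rw [geomPoly, mul_comm]
  exact geom_sum_mul X (n + 1)

theorem X_sub_one_ne_zero' : (X - 1 : ℤ[X]) ≠ 0 := by
  simpa using X_sub_C_ne_zero (1 : ℤ)

/-- One unit of degree passes from the shorter factor to the longer one. After multiplication by (X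
- 1)² this is an identity between powers of X. -/
theorem geomPoly_mul_geomPoly_succ (b e : ℕ) :
    geomPoly (b + 1 + e) * geomPoly (b + 1) =
      geomPoly (b + 1 + e + 1) * geomPoly b + X ^ (b + 1) * geomPoly e := by
  apply mul_left_cancel₀ (mul_ne_zero X_sub_one_ne_zero' X_sub_one_ne_zero')
  have e1 := X_sub_one_mul_geomPoly (b + 1 + e)
  have e2 := X_sub_one_mul_geomPoly (b + 1)
  have e3 := X_sub_one_mul_geomPoly (b + 1 + e + 1)
  have e4 := X_sub_one_mul_geomPoly b
  have e5 := X_sub_one_mul_geomPoly e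
  calc _ = ((X - 1) * geomPoly (b + 1 + e)) * ((X - 1) * geomPoly (b + 1)) := by ring
    _ = ((X - 1) * geomPoly (b + 1 + e + 1)) * ((X - 1) * geomPoly b) +
        (X - 1) * X ^ (b + 1) * ((X - 1) * geomPoly e) := by
      rw [e1, e2, e3, e4, e5]; ring
    _ = _ := by ring

/-- Induction on the shorter factor: if the longer one has reached a = i, the product is itself some
P; otherwise a unit of degree is moved, leaving X^(b+1) P_{qi+e}, which has the right symmetry
degree. -/
theorem inGCone_geomPoly_mul_of_le {i : ℕ} (hi : 1 ≤ i) (q r : ℕ) :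
    ∀ a, r ≤ a → a ≤ i →
      InGCone i (q * i + a + r) (geomPoly i ^ q * (geomPoly a * geomPoly r)) := by
  induction r with
  | zero =>
    intro a _ ha
    have := InGCone.X_pow_mul_gP (i := i) (d := q * i + a + 0) (e := q * i + a) (j := 0) rfl
    rw [gP_mul_add hi q a ha] at this
    simpa [geomPoly] using this
  | succ b ih =>
    intro a hba ha
    rcases ha.eq_or_lt with rfl | hlt
    · have := InGCone.X_pow_mul_gP (i := a) (d := q * a + a + (b + 1))
        (e := (q + 1) * a + (b + 1)) (j := 0) (by ring)
      rw [gP_mul_add hi (q + 1) (b + 1) hba, pow_succ, pow_zero, one_mul, mul_assoc] at this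
      exact this
    · obtain ⟨e, rfl⟩ := Nat.exists_eq_add_of_le hba
      rw [geomPoly_mul_geomPoly_succ, mul_add]
      refine InGCone.add ?_ ?_
      · have := ih (b + 1 + e + 1) (by omega) hlt
        convert this using 1; ring
      · have := InGCone.X_pow_mul_gP (i := i) (d := q * i + (b + 1 + e) + (b + 1))
          (e := q * i + e) (j := b + 1) (by ring)
        rw [gP_mul_add hi q e (by omega)] at this
        convert this using 1; ring

theorem inGCone_geomPoly_mul_gP {i a : ℕ} (hi : 1 ≤ i) (ha : a ≤ i) (n : ℕ) :
    InGCone i (n + a) (geomPoly a * gP n i) := by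
  have hn : n = n / i * i + n % i := (Nat.div_add_mod' n i).symm
  have hr : n % i ≤ i := (Nat.mod_lt n (by omega)).le
  have h : gP n i = geomPoly i ^ (n / i) * geomPoly (n % i) := by
    conv_lhs => rw [hn]
    exact gP_mul_add hi _ _ hr
  rw [h]
  rcases le_total (n % i) a with hle | hle
  · have := inGCone_geomPoly_mul_of_le hi (n / i) (n % i) a hle ha
    convert this using 1
    · omega
    · ring
  · have := inGCone_geomPoly_mul_of_le hi (n / i) a (n % i) hle hr
    convert this using 1
    · omega
    · ring

theorem InGCone.geomPoly_mul {i a n : ℕ} (hi : 1 ≤ i) (ha : a ≤ i) {p : ℤ[X]}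
    (hp : InGCone i n p) : InGCone i (n + a) (geomPoly a * p) := by
  obtain ⟨c, hc, rfl⟩ := hp
  rw [Finset.mul_sum]
  refine InGCone.sum _ _ fun k _ => ?_
  rw [mul_smul_comm]
  refine InGCone.smul ?_ (hc k)
  rw [gBasis, mul_left_comm]
  exact InGCone.X_pow_mul (e := n - 2 * k + a) (by have := k.2; omega)
    (inGCone_geomPoly_mul_gP hi ha _)

/-! ### Palindromic polynomials -/

/-- `p` has degree at most `d` and its coefficients are symmetric: `t^d p(1/t) = p(t)`. -/
def IsPalindromic (d : ℕ) (p : ℤ[X]) : Prop := p.natDegree ≤ d ∧ p.reflect d = p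

theorem IsPalindromic.mul {d e : ℕ} {p q : ℤ[X]} (hp : IsPalindromic d p)
    (hq : IsPalindromic e q) : IsPalindromic (d + e) (p * q) :=
  ⟨natDegree_mul_le_of_le hp.1 hq.1, by rw [reflect_mul _ _ hp.1 hq.1, hp.2, hq.2]⟩

theorem IsPalindromic.one : IsPalindromic 0 1 := by simp [IsPalindromic]

theorem IsPalindromic.pow {d : ℕ} {p : ℤ[X]} (hp : IsPalindromic d p) (n : ℕ) :
    IsPalindromic (n * d) (p ^ n) := by
  induction n with
  | zero => simpa using IsPalindromic.one
  | succ n ih =>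
    rw [pow_succ, Nat.succ_mul]
    exact ih.mul hp

theorem geomPoly_coeff (n k : ℕ) : (geomPoly n).coeff k = if k ≤ n then 1 else 0 := by
  simp [geomPoly, Polynomial.finsetSum_coeff, Polynomial.coeff_X_pow]

theorem isPalindromic_iff {d : ℕ} {p : ℤ[X]} : IsPalindromic d p ↔
    (∀ k, d < k → p.coeff k = 0) ∧ ∀ k, k ≤ d → p.coeff (d - k) = p.coeff k := by
  unfold IsPalindromic
  rw [natDegree_le_iff_coeff_eq_zero]
  refine and_congr_right fun h => ?_
  rw [Polynomial.ext_iff]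
  refine ⟨fun h' k hk => ?_, fun h' k => ?_⟩
  · have := h' k
    rwa [coeff_reflect, revAt_le hk] at this
  · rw [coeff_reflect]
    rcases le_or_gt k d with hk | hk
    · rw [revAt_le hk, h' k hk]
    · rw [revAt_eq_self_of_lt hk]

theorem isPalindromic_geomPoly (n : ℕ) : IsPalindromic n (geomPoly n) := by
  rw [isPalindromic_iff]
  refine ⟨fun k hk => ?_, fun k hk => ?_⟩
  · rw [geomPoly_coeff, if_neg (by omega)]
  · rw [geomPoly_coeff, geomPoly_coeff, if_pos (by omega), if_pos hk]

theorem isPalindromic_gP {i : ℕ} (hi : 1 ≤ i) (n : ℕ) : IsPalindromic n (gP n i) := by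
  have hn : n = n / i * i + n % i := (Nat.div_add_mod' n i).symm
  have h := gP_mul_add hi (n / i) (n % i) (Nat.mod_lt n (by omega)).le
  rw [← hn] at h
  rw [h]
  have := ((isPalindromic_geomPoly i).pow (n / i)).mul (isPalindromic_geomPoly (n % i))
  rwa [← hn] at this

theorem InGSpan.X_mul {i d : ℕ} {p : ℤ[X]} (hp : InGSpan i d p) :
    InGSpan i (d + 2) (X * p) := by
  unfold InGSpan at hp
  induction hp using Submodule.span_induction with
  | mem x hx =>
    obtain ⟨j, rfl⟩ := hx
    have := InGCone.X_pow_mul_gP (i := i) (d := d + 2) (e := d - 2 * j) (j := j + 1)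
      (by have := j.2; omega)
    rw [gBasis, ← mul_assoc, ← pow_succ']
    exact this.inGSpan
  | zero => simpa using (InGCone.zero i (d + 2)).inGSpan
  | add x y _ _ hx hy => rw [mul_add]; exact Submodule.add_mem _ hx hy
  | smul a x _ hx => rw [mul_smul_comm]; exact Submodule.smul_mem _ _ hx

/-- Since P_{d,i} is palindromic with constant term 1, subtracting p(0) P_{d,i} kills the
coefficients at 0 and d. What remains is X times a palindromic polynomial of degree d - 2, and no
division is needed. -/
theorem inGSpan_of_isPalindromic {i : ℕ} (hi : 1 ≤ i) (d : ℕ) :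
    ∀ p : ℤ[X], IsPalindromic d p → InGSpan i d p := by
  induction d using Nat.strong_induction_on with
  | _ d ih =>
    intro p hp
    have hP : InGSpan i d (gP d i) := by
      simpa using (InGCone.X_pow_mul_gP (i := i) (d := d) (e := d) (j := 0) rfl).inGSpan
    have hpal := isPalindromic_gP hi d
    rw [isPalindromic_iff] at hp hpal
    set r := p - p.coeff 0 • gP d i with hr
    have hr0 : r.coeff 0 = 0 := by simp [hr, gP_coeff_zero]
    have hrc (k : ℕ) : r.coeff k = p.coeff k - p.coeff 0 * (gP d i).coeff k := by simp [hr]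
    have hrhi (k : ℕ) (hk : d < k) : r.coeff k = 0 := by rw [hrc, hp.1 k hk, hpal.1 k hk]; simp
    have hrsym (k : ℕ) (hk : k ≤ d) : r.coeff (d - k) = r.coeff k := by
      rw [hrc, hrc, hp.2 k hk, hpal.2 k hk]
    have hrd : r.coeff d = 0 := by rw [← hr0, ← hrsym 0 (Nat.zero_le _), Nat.sub_zero]
    have hpr : p = r + p.coeff 0 • gP d i := by simp [hr]
    have hdX : r = X * r.divX := by
      conv_lhs => rw [← X_mul_divX_add r]
      simp [hr0]
    suffices InGSpan i d r by
      rw [hpr]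
      exact Submodule.add_mem _ this (Submodule.smul_mem _ _ hP)
    rcases Nat.lt_or_ge d 2 with hd | hd
    · have : r = 0 := by
        ext k
        rw [coeff_zero]
        rcases Nat.lt_trichotomy k d with h | h | h
        · obtain rfl : k = 0 := by omega
          exact hr0
        · rw [h]; exact hrd
        · exact hrhi k h
      rw [this]
      exact Submodule.zero_mem _
    · obtain ⟨e, rfl⟩ : ∃ e, d = e + 2 := ⟨d - 2, by omega⟩
      rw [hdX]
      refine InGSpan.X_mul (ih e (by omega) _ ?_)
      rw [isPalindromic_iff]
      refine ⟨fun k hk => ?_, fun k hk => ?_⟩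
      · rw [coeff_divX]
        rcases Nat.lt_or_ge (e + 2) (k + 1) with h | h
        · exact hrhi _ h
        · rw [show k + 1 = e + 2 by omega]; exact hrd
      · rw [coeff_divX, coeff_divX, ← hrsym (k + 1) (by omega)]
        congr 1
        omega

end

noncomputable section

namespace SimpComplex

/-! ### Contraction and wedge operators on chains -/

section Chains

/-- A linear map sends chains supported in `s` to a submodule as soon as it sends the simplices
in `s` there. -/
theorem map_mem_of_mem_supported {α R : Type*} [CommRing R] {s : Set (α)} {p : Submodule R (α →₀ R)}
    (f : (α →₀ R) →ₗ[R] (α →₀ R))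
    (h : ∀ σ ∈ s, ∀ r : R, f (Finsupp.single σ r) ∈ p) {c : α →₀ R}
    (hc : c ∈ Finsupp.supported R R s) : f c ∈ p := by
  rw [← Finsupp.sum_single c, Finsupp.sum, map_sum]
  exact Submodule.sum_mem _ fun σ hσ => h σ (hc hσ) _

variable {V : Type*} [LinearOrder V] (R : Type*) [CommRing R]

/-- The sign with which `σ \ {v}` occurs in the boundary of `σ`. -/
def vertexSign (σ : Finset V) (v : V) : R := (-1 : R) ^ #{w ∈ σ | w < v}

theorem vertexSign_mul_self (σ : Finset V) (v : V) :
    vertexSign R σ v * vertexSign R σ v = 1 := by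
  rw [vertexSign, ← mul_pow]; simp

theorem vertexSign_insert_self {σ : Finset V} (v : V) :
    vertexSign R (insert v σ) v = vertexSign R σ v := by
  simp [vertexSign, Finset.filter_insert]

theorem vertexSign_erase_self {σ : Finset V} (v : V) :
    vertexSign R (σ.erase v) v = vertexSign R σ v := by
  unfold vertexSign
  congr 2
  ext w
  simp only [mem_filter, mem_erase]
  exact ⟨fun h => ⟨h.1.2, h.2⟩, fun h => ⟨⟨h.2.ne, h.1⟩, h.2⟩⟩

theorem vertexSign_insert {σ : Finset V} {x : V} (hx : x ∉ σ) (v : V) :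
    vertexSign R (insert x σ) v = (if x < v then -1 else 1) * vertexSign R σ v := by
  unfold vertexSign
  rw [Finset.filter_insert]
  split_ifs with h
  · rw [card_insert_of_notMem (by simp [hx]), pow_succ']
  · rw [one_mul]

theorem vertexSign_erase {σ : Finset V} {x : V} (hx : x ∈ σ) (v : V) :
    vertexSign R (σ.erase x) v = (if x < v then -1 else 1) * vertexSign R σ v := by
  conv_rhs => rw [← insert_erase hx]
  rw [vertexSign_insert R (notMem_erase x σ)]
  split_ifs <;> simp

theorem boundaryMap_single (σ : Finset V) (r : R) : boundaryMap R (Finsupp.single σ r) =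
    ∑ v ∈ σ, Finsupp.single (σ.erase v) (r * vertexSign R σ v) := by
  simp [boundaryMap, vertexSign, Finset.smul_sum]

/-- The wedge operator `σ ↦ x ∧ σ`. -/
def wedge (x : V) : (Finset V →₀ R) →ₗ[R] (Finset V →₀ R) :=
  Finsupp.linearCombination R fun σ : Finset V =>
    if x ∈ σ then 0 else Finsupp.single (insert x σ) (vertexSign R σ x)

/-- The contraction operator, which removes `x` from a simplex (with sign), and is `0` on the
simplices without `x`. -/
def contract (x : V) : (Finset V →₀ R) →ₗ[R] (Finset V →₀ R) :=
  Finsupp.linearCombination R fun σ : Finset V =>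
    if x ∈ σ then Finsupp.single (σ.erase x) (vertexSign R σ x) else 0

theorem wedge_single_of_mem {x : V} {σ : Finset V} (h : x ∈ σ) (r : R) :
    wedge R x (Finsupp.single σ r) = 0 := by simp [wedge, h]

theorem wedge_single_of_notMem {x : V} {σ : Finset V} (h : x ∉ σ) (r : R) :
    wedge R x (Finsupp.single σ r) = Finsupp.single (insert x σ) (r * vertexSign R σ x) := by
  simp [wedge, h]

theorem contract_single_of_mem {x : V} {σ : Finset V} (h : x ∈ σ) (r : R) :
    contract R x (Finsupp.single σ r) = Finsupp.single (σ.erase x) (r * vertexSign R σ x) := by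
  simp [contract, h]

theorem contract_single_of_notMem {x : V} {σ : Finset V} (h : x ∉ σ) (r : R) :
    contract R x (Finsupp.single σ r) = 0 := by simp [contract, h]

/-- The cone homotopy. If x ∈ σ, only the term of the boundary without x survives the wedge. If x ∉
σ, the terms for v ∈ σ cancel, because exactly one of x < v and v < x flips a sign. -/
theorem boundaryMap_wedge (x : V) (c : Finset V →₀ R) :
    boundaryMap R (wedge R x c) = c - wedge R x (boundaryMap R c) := by
  rw [eq_sub_iff_add_eq]
  induction c using Finsupp.induction_linear with
  | zero => simp
  | add c e hc he =>
    simp only [map_add]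
    rw [add_add_add_comm, hc, he]
  | single σ r =>
    rw [boundaryMap_single, map_sum]
    by_cases hx : x ∈ σ
    · rw [wedge_single_of_mem R hx, map_zero, zero_add, Finset.sum_eq_single x]
      · rw [wedge_single_of_notMem R (notMem_erase x σ), insert_erase hx,
          vertexSign_erase_self, mul_assoc, vertexSign_mul_self, mul_one]
      · intro v _ hv
        exact wedge_single_of_mem R (mem_erase.2 ⟨hv.symm, hx⟩) _
      · exact fun h => absurd hx h
    · rw [wedge_single_of_notMem R hx, boundaryMap_single, sum_insert hx, erase_insert hx,
        vertexSign_insert_self, mul_assoc, vertexSign_mul_self, mul_one, add_assoc,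
        ← Finset.sum_add_distrib, Finset.sum_eq_zero, add_zero]
      intro v hv
      have hvx : v ≠ x := fun h => hx (h ▸ hv)
      rw [wedge_single_of_notMem R (fun h => hx (mem_of_mem_erase h)),
        erase_insert_of_ne hvx.symm, ← Finsupp.single_add, vertexSign_insert R hx,
        vertexSign_erase R hv]
      rw [Finsupp.single_eq_zero]
      rcases lt_or_gt_of_ne hvx with h | h
      · rw [if_neg h.not_gt, if_pos h]; ring
      · rw [if_pos h, if_neg h.not_gt]; ring

/-- A nonempty simplex is, up to sign, a wedge x ∧ σ, so two uses of the cone formula reduce the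
claim to σ. -/
theorem boundaryMap_boundaryMap (c : Finset V →₀ R) : boundaryMap R (boundaryMap R c) = 0 := by
  induction c using Finsupp.induction_linear with
  | zero => simp
  | add c e hc he => simp only [map_add, hc, he, add_zero]
  | single σ r =>
    induction σ using Finset.induction_on generalizing r with
    | empty => simp [boundaryMap_single]
    | insert x σ hx ih =>
      have h : Finsupp.single (insert x σ) r
          = wedge R x (Finsupp.single σ (r * vertexSign R σ x)) := by
        rw [wedge_single_of_notMem R hx, mul_assoc, vertexSign_mul_self, mul_one]
      rw [h, boundaryMap_wedge, map_sub, boundaryMap_wedge, ih, map_zero, sub_zero, sub_self]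

theorem boundaryMap_contract (x : V) (c : Finset V →₀ R) :
    boundaryMap R (contract R x c) = - contract R x (boundaryMap R c) := by
  rw [eq_neg_iff_add_eq_zero]
  induction c using Finsupp.induction_linear with
  | zero => simp
  | add c e hc he =>
    simp only [map_add]
    rw [add_add_add_comm, hc, he, add_zero]
  | single σ r =>
    rw [boundaryMap_single, map_sum]
    by_cases hx : x ∈ σ
    · rw [contract_single_of_mem R hx, boundaryMap_single, ← Finset.add_sum_erase σ _ hx,
        contract_single_of_notMem R (notMem_erase x σ), zero_add, ← Finset.sum_add_distrib,
        Finset.sum_eq_zero]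
      intro v hv
      obtain ⟨hvx, hv⟩ := mem_erase.1 hv
      rw [contract_single_of_mem R (mem_erase.2 ⟨hvx.symm, hx⟩), erase_right_comm,
        ← Finsupp.single_add, vertexSign_erase R hx, vertexSign_erase R hv]
      rw [Finsupp.single_eq_zero]
      rcases lt_or_gt_of_ne hvx with h | h
      · rw [if_neg h.not_gt, if_pos h]; ring
      · rw [if_pos h, if_neg h.not_gt]; ring
    · rw [contract_single_of_notMem R hx, map_zero, zero_add]
      exact Finset.sum_eq_zero fun v _ =>
        contract_single_of_notMem R (fun h => hx (mem_of_mem_erase h)) _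

theorem contract_eq_zero {x : V} {s : Set (Finset V)} (h : ∀ σ ∈ s, x ∉ σ) {c : Finset V →₀ R}
    (hc : c ∈ Finsupp.supported R R s) : contract R x c = 0 := by
  rw [← Submodule.mem_bot R]
  exact map_mem_of_mem_supported _
    (fun σ hσ r => by rw [contract_single_of_notMem R (h σ hσ)]; exact Submodule.zero_mem _) hc

theorem contract_wedge {x : V} {s : Set (Finset V)} (h : ∀ σ ∈ s, x ∉ σ) {c : Finset V →₀ R}
    (hc : c ∈ Finsupp.supported R R s) : contract R x (wedge R x c) = c := by
  rw [← sub_eq_zero, ← Submodule.mem_bot R]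
  refine map_mem_of_mem_supported (contract R x ∘ₗ wedge R x - LinearMap.id)
    (fun σ hσ r => ?_) hc
  rw [Submodule.mem_bot, LinearMap.sub_apply, LinearMap.comp_apply,
    wedge_single_of_notMem R (h σ hσ), contract_single_of_mem R (mem_insert_self x σ),
    erase_insert (h σ hσ), vertexSign_insert_self, mul_assoc, vertexSign_mul_self, mul_one]
  simp

/-- Erasing x is injective on the simplices containing x, so contraction causes no cancellation. -/
theorem mem_supported_of_contract_eq_zero {x : V} {s : Set (Finset V)} {c : Finset V →₀ R}
    (hc : c ∈ Finsupp.supported R R s) (h : contract R x c = 0) :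
    c ∈ Finsupp.supported R R {σ | σ ∈ s ∧ x ∉ σ} := by
  intro σ hσ
  refine ⟨hc hσ, fun hx => ?_⟩
  have key : ∀ c : Finset V →₀ R, contract R x c (σ.erase x) = c σ * vertexSign R σ x := by
    intro c
    induction c using Finsupp.induction_linear with
    | zero => simp
    | add c e hc he => rw [map_add, Finsupp.add_apply, hc, he, Finsupp.add_apply, add_mul]
    | single τ r =>
      by_cases hτ : x ∈ τ
      · rw [contract_single_of_mem R hτ]
        by_cases e : τ = σ
        · subst e; simp
        · have : τ.erase x ≠ σ.erase x := fun e' => e (by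
            rw [← insert_erase hτ, e', insert_erase hx])
          rw [Finsupp.single_eq_of_ne this.symm, Finsupp.single_eq_of_ne (Ne.symm e), zero_mul]
      · rw [contract_single_of_notMem R hτ, Finsupp.single_eq_of_ne (by rintro rfl; exact hτ hx)]
        simp
  have h2 := key c
  rw [h, Finsupp.zero_apply] at h2
  have h3 : c σ = 0 := by
    rw [← mul_one (c σ), ← vertexSign_mul_self R σ x, ← mul_assoc, ← h2, zero_mul]
  exact (Finsupp.mem_support_iff.1 hσ) h3

end Chains

end SimpComplex
end

noncomputable section

namespace SimpComplex

section Homology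

theorem chains_le_supported {V : Type*} (R : Type*) [CommRing R] (K : SimpComplex V) (m : ℕ) :
    K.chains R m ≤ Finsupp.supported R R {σ | σ ∈ K} :=
  Finsupp.supported_mono fun _ h => h.1

variable {V : Type*} [LinearOrder V] (R : Type*) [CommRing R]

/-! ### Comparison of homology modules -/

theorem boundaryMap_mem_chains (K : SimpComplex V) {m : ℕ} {c : Finset V →₀ R}
    (hc : c ∈ K.chains R (m + 1)) : boundaryMap R c ∈ K.chains R m := by
  refine map_mem_of_mem_supported _ (fun σ hσ r => ?_) hc
  rw [boundaryMap_single]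
  refine Submodule.sum_mem _ fun v hv => Finsupp.single_mem_supported R _ ⟨?_, ?_⟩
  · exact K.down_closed _ hσ.1 _ (erase_subset v σ)
  · rw [card_erase_of_mem hv, hσ.2, Nat.add_sub_cancel]

theorem boundaryMap_mem_supported (K : SimpComplex V) {c : Finset V →₀ R}
    (hc : c ∈ Finsupp.supported R R {σ | σ ∈ K}) :
    boundaryMap R c ∈ Finsupp.supported R R {σ | σ ∈ K} := by
  refine map_mem_of_mem_supported _ (fun σ hσ r => ?_) hc
  rw [boundaryMap_single]
  exact Submodule.sum_mem _ fun v hv => Finsupp.single_mem_supported R _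
    (K.down_closed _ hσ _ (erase_subset v σ))

theorem wedge_mem_supported {x : V} {s t : Set (Finset V)}
    (h : ∀ σ ∈ s, x ∉ σ → insert x σ ∈ t) {c : Finset V →₀ R}
    (hc : c ∈ Finsupp.supported R R s) : wedge R x c ∈ Finsupp.supported R R t := by
  refine map_mem_of_mem_supported _ (fun σ hσ r => ?_) hc
  by_cases hx : x ∈ σ
  · rw [wedge_single_of_mem R hx]
    exact Submodule.zero_mem _
  · rw [wedge_single_of_notMem R hx]
    exact Finsupp.single_mem_supported R _ (h σ hσ hx)

theorem contract_mem_supported {x : V} {s t : Set (Finset V)}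
    (h : ∀ σ ∈ s, x ∈ σ → σ.erase x ∈ t) {c : Finset V →₀ R}
    (hc : c ∈ Finsupp.supported R R s) : contract R x c ∈ Finsupp.supported R R t := by
  refine map_mem_of_mem_supported _ (fun σ hσ r => ?_) hc
  by_cases hx : x ∈ σ
  · rw [contract_single_of_mem R hx]
    exact Finsupp.single_mem_supported R _ (h σ hσ hx)
  · rw [contract_single_of_notMem R hx]
    exact Submodule.zero_mem _

theorem boundaries_le_cycles (K : SimpComplex V) (m : ℕ) : K.boundaries R m ≤ K.cycles R m := by
  rintro _ ⟨c, hc, rfl⟩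
  exact ⟨boundaryMap_mem_chains R K hc, boundaryMap_boundaryMap R c⟩

variable {R} in
/-- A linear map which is bijective on cycles modulo boundaries induces an isomorphism of the
subquotients. -/
theorem nonempty_map_mkQ_equiv {M N : Type*} [AddCommGroup M] [Module R M] [AddCommGroup N]
    [Module R N] {Z B : Submodule R M} {Z' B' : Submodule R N} (f : M →ₗ[R] N)
    (hZ : ∀ z ∈ Z, f z ∈ Z') (hB : ∀ b ∈ B, f b ∈ B')
    (hinj : ∀ z ∈ Z, f z ∈ B' → z ∈ B) (hsurj : ∀ z' ∈ Z', ∃ z ∈ Z, f z - z' ∈ B') :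
    Nonempty (Z.map B.mkQ ≃ₗ[R] Z'.map B'.mkQ) := by
  have hmap : ∀ y ∈ Z.map B.mkQ, B.mapQ B' f hB y ∈ Z'.map B'.mkQ := by
    rintro _ ⟨z, hz, rfl⟩
    exact ⟨f z, hZ z hz, rfl⟩
  refine ⟨LinearEquiv.ofBijective ((B.mapQ B' f hB).restrict hmap) ⟨?_, ?_⟩⟩
  · rw [← LinearMap.ker_eq_bot, LinearMap.ker_eq_bot']
    rintro ⟨_, z, hz, rfl⟩ h
    have h' : B'.mkQ (f z) = 0 := congrArg Subtype.val h
    rw [Submodule.mkQ_apply, Submodule.Quotient.mk_eq_zero] at h'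
    refine Subtype.ext ?_
    change B.mkQ z = 0
    rw [Submodule.mkQ_apply, Submodule.Quotient.mk_eq_zero]
    exact hinj z hz h'
  · rintro ⟨_, z', hz', rfl⟩
    obtain ⟨z, hz, h⟩ := hsurj z' hz'
    refine ⟨⟨B.mkQ z, z, hz, rfl⟩, Subtype.ext ?_⟩
    exact (Submodule.Quotient.eq B').2 h

theorem subsingleton_reducedHomology_of_le {K : SimpComplex V} {m : ℕ}
    (h : K.cycles R m ≤ K.boundaries R m) : Subsingleton (K.reducedHomology R m) := by
  rw [Submodule.subsingleton_iff_eq_bot, reducedHomology, eq_bot_iff]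
  rintro _ ⟨z, hz, rfl⟩
  rw [Submodule.mem_bot, Submodule.mkQ_apply, Submodule.Quotient.mk_eq_zero]
  exact h hz

/-- If the faces of `W` outside the subcomplex `L` are closed under adding and removing the
vertex `x`, a chain of `W` with boundary in `L` is homologous to a chain of `L`. -/
theorem exists_sub_boundaryMap_mem_chains {L W : SimpComplex V} {x : V}
    (htog : ∀ σ, x ∉ σ → ((σ ∈ W ∧ σ ∉ L) ↔ (insert x σ ∈ W ∧ insert x σ ∉ L)))
    {m : ℕ} {c : Finset V →₀ R} (hc : c ∈ W.chains R m)
    (hb : boundaryMap R c ∈ Finsupp.supported R R {σ | σ ∈ L}) :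
    ∃ e ∈ W.chains R (m + 1), c - boundaryMap R e ∈ L.chains R m := by
  classical
  -- Split c into its part in L and its part outside, and take e = x ∧ c₁. Then c - ∂e = c₀ + x ∧
  -- ∂c₁.
  set c₀ := c.filter (· ∈ L) with hc₀
  set c₁ := c.filter (¬ · ∈ L) with hc₁
  have hadd : c₀ + c₁ = c := Finsupp.filter_add_filter_not c _
  have h₀ : c₀ ∈ L.chains R m := by
    intro σ hσ
    rw [mem_coe, hc₀, Finsupp.support_filter, mem_filter] at hσ
    exact ⟨hσ.2, (hc hσ.1).2⟩
  have h₁ : c₁ ∈ Finsupp.supported R R {σ | (σ ∈ W ∧ σ ∉ L) ∧ #σ = m} := by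
    intro σ hσ
    rw [mem_coe, hc₁, Finsupp.support_filter, mem_filter] at hσ
    exact ⟨⟨(hc hσ.1).1, hσ.2⟩, (hc hσ.1).2⟩
  have h₁' : c₁ ∈ W.chains R m := fun σ h => ⟨(h₁ h).1.1, (h₁ h).2⟩
  have he : wedge R x c₁ ∈ W.chains R (m + 1) :=
    wedge_mem_supported R (t := {σ | σ ∈ W ∧ #σ = m + 1}) (fun σ hσ hx =>
      ⟨((htog σ hx).1 hσ.1).1, by rw [card_insert_of_notMem hx, hσ.2]⟩) h₁
  have hb₁ : boundaryMap R c₁ ∈ Finsupp.supported R R {σ | σ ∈ L} := by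
    have : boundaryMap R c₁ = boundaryMap R c - boundaryMap R c₀ := by
      rw [← hadd, map_add, add_sub_cancel_left]
    rw [this]
    exact Submodule.sub_mem _ hb (boundaryMap_mem_supported R L (chains_le_supported R L m h₀))
  have hw : wedge R x (boundaryMap R c₁) ∈ L.chains R m := by
    have hW : wedge R x (boundaryMap R c₁) ∈ W.chains R m := by
      have : wedge R x (boundaryMap R c₁) = c₁ - boundaryMap R (wedge R x c₁) := by
        rw [boundaryMap_wedge, sub_sub_cancel]
      rw [this]
      exact Submodule.sub_mem _ h₁' (boundaryMap_mem_chains R W he)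
    -- Since ∂c₁ lies in L, adding x cannot lead to a face of W outside L: the toggle would take
    -- that face back outside L.
    have hL : wedge R x (boundaryMap R c₁) ∈
        Finsupp.supported R R {σ | ¬ (σ ∈ W ∧ σ ∉ L)} :=
      wedge_mem_supported R (s := {σ | σ ∈ L}) (t := {σ | ¬ (σ ∈ W ∧ σ ∉ L)})
        (fun σ hσ hx h => ((htog σ hx).2 h).2 hσ) hb₁
    intro σ hσ
    exact ⟨not_not.1 fun h => hL hσ ⟨(hW hσ).1, h⟩, (hW hσ).2⟩
  refine ⟨wedge R x c₁, he, ?_⟩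
  rw [boundaryMap_wedge, ← hadd, sub_sub_eq_add_sub, add_sub_right_comm, add_sub_cancel_right]
  exact Submodule.add_mem _ h₀ hw

/-- Pairing σ with σ ∪ {x} makes the relative complex of (W, L) acyclic, so inclusion is an
isomorphism on homology. Pushing a bounding chain into L gives injectivity; pushing a cycle into L
gives surjectivity. -/
theorem nonempty_reducedHomology_equiv_of_toggle {L W : SimpComplex V} (x : V)
    (hLW : ∀ σ ∈ L, σ ∈ W)
    (htog : ∀ σ, x ∉ σ → ((σ ∈ W ∧ σ ∉ L) ↔ (insert x σ ∈ W ∧ insert x σ ∉ L))) (m : ℕ) :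
    Nonempty (L.reducedHomology R m ≃ₗ[R] W.reducedHomology R m) := by
  have hch (n : ℕ) : L.chains R n ≤ W.chains R n :=
    Finsupp.supported_mono fun σ h => ⟨hLW σ h.1, h.2⟩
  refine nonempty_map_mkQ_equiv LinearMap.id (fun z hz => ⟨hch m hz.1, hz.2⟩) ?_ ?_ ?_
  · rintro _ ⟨c, hc, rfl⟩
    exact ⟨c, hch _ hc, rfl⟩
  · rintro _ hz ⟨b, hb, rfl⟩
    obtain ⟨e, -, he⟩ := exists_sub_boundaryMap_mem_chains R htog hb
      (chains_le_supported R L m hz.1)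
    exact ⟨_, he, by rw [map_sub, boundaryMap_boundaryMap, sub_zero]⟩
  · intro z hz
    have hz2 : boundaryMap R z = 0 := hz.2
    obtain ⟨e, he, he'⟩ := exists_sub_boundaryMap_mem_chains R htog hz.1
      (by rw [hz2]; exact Submodule.zero_mem _)
    refine ⟨_, ⟨he', ?_⟩, ⟨-e, Submodule.neg_mem _ he, ?_⟩⟩
    · change boundaryMap R _ = 0
      rw [map_sub, hz2, boundaryMap_boundaryMap, sub_zero]
    · rw [map_neg, LinearMap.id_apply, sub_sub_cancel_left]

/-! ### Suspension: a vertex whose deletion is a cone -/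

theorem mem_link {K : SimpComplex V} {σ τ : Finset V} :
    τ ∈ K.link σ ↔ Disjoint σ τ ∧ σ ∪ τ ∈ K := by
  change τ ∈ filter _ _ ↔ _
  rw [mem_filter]
  exact ⟨fun h => h.2, fun h => ⟨K.down_closed _ h.2 _ subset_union_right, h⟩⟩

theorem wedge_mem_supported_of_cone {X : SimpComplex V} {g y : V} (hgy : y ≠ g)
    (hcone : ∀ σ ∈ X, g ∉ σ → insert y σ ∈ X) {m : ℕ} {c : Finset V →₀ R}
    (hc : c ∈ Finsupp.supported R R {σ | (σ ∈ X ∧ #σ = m) ∧ g ∉ σ}) :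
    wedge R y c ∈ Finsupp.supported R R {σ | (σ ∈ X ∧ #σ = m + 1) ∧ g ∉ σ} := by
  refine wedge_mem_supported R (t := {σ | (σ ∈ X ∧ #σ = m + 1) ∧ g ∉ σ})
    (fun σ hσ hy => ⟨⟨hcone σ hσ.1.1 hσ.2, ?_⟩, ?_⟩) hc
  · rw [card_insert_of_notMem hy, hσ.1.2]
  · rw [mem_insert, not_or]
    exact ⟨hgy.symm, hσ.2⟩

/-- A cycle of the deletion of `g` is a boundary if that deletion is a cone. -/
theorem mem_boundaries_of_cone {X : SimpComplex V} {g y : V} (hgy : y ≠ g)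
    (hcone : ∀ σ ∈ X, g ∉ σ → insert y σ ∈ X) {m : ℕ} {c : Finset V →₀ R}
    (hc : c ∈ Finsupp.supported R R {σ | (σ ∈ X ∧ #σ = m) ∧ g ∉ σ})
    (hc' : boundaryMap R c = 0) : c ∈ X.boundaries R m := by
  refine ⟨wedge R y c, fun σ hσ => (wedge_mem_supported_of_cone R hgy hcone hc hσ).1, ?_⟩
  rw [boundaryMap_wedge, hc', map_zero, sub_zero]

/-- X is the union of the star of g and a cone with apex y, glued along the link of g, hence
homologically a suspension of that link. Contraction by g realises the isomorphism. -/
theorem nonempty_reducedHomology_equiv_link {X : SimpComplex V} {g y : V} (hgy : y ≠ g)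
    (hcone : ∀ σ ∈ X, g ∉ σ → insert y σ ∈ X) (m : ℕ) :
    Nonempty (X.reducedHomology R (m + 1) ≃ₗ[R] (X.link {g}).reducedHomology R m) := by
  have hlink {n : ℕ} {c : Finset V →₀ R} (hc : c ∈ X.chains R (n + 1)) :
      contract R g c ∈ (X.link {g}).chains R n := by
    refine contract_mem_supported R (t := {σ | σ ∈ X.link {g} ∧ #σ = n}) (fun σ hσ hg => ?_) hc
    refine ⟨mem_link.2 ⟨disjoint_singleton_left.2 (notMem_erase g σ), ?_⟩, ?_⟩
    · rw [← insert_eq, insert_erase hg]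
      exact hσ.1
    · rw [card_erase_of_mem hg, hσ.2, Nat.add_sub_cancel]
  have hnot (n : ℕ) : ∀ σ ∈ {σ | σ ∈ X.link {g} ∧ #σ = n}, g ∉ σ :=
    fun σ hσ => disjoint_singleton_left.1 (mem_link.1 hσ.1).1
  have hwedge {n : ℕ} {c : Finset V →₀ R} (hc : c ∈ (X.link {g}).chains R n) :
      wedge R g c ∈ X.chains R (n + 1) := by
    refine wedge_mem_supported R (t := {σ | σ ∈ X ∧ #σ = n + 1}) (fun σ hσ hg => ⟨?_, ?_⟩) hc
    · rw [insert_eq]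
      exact (mem_link.1 hσ.1).2
    · rw [card_insert_of_notMem hg, hσ.2]
  refine nonempty_map_mkQ_equiv (contract R g) ?_ ?_ ?_ ?_
  · intro z hz
    have hz2 : boundaryMap R z = 0 := hz.2
    refine ⟨hlink hz.1, ?_⟩
    change boundaryMap R _ = 0
    rw [boundaryMap_contract, hz2, map_zero, neg_zero]
  · rintro _ ⟨c, hc, rfl⟩
    refine ⟨-contract R g c, Submodule.neg_mem _ (hlink hc), ?_⟩
    rw [map_neg, boundaryMap_contract, neg_neg]
  · rintro z hz ⟨b, hb, hbz⟩
    have hz2 : boundaryMap R z = 0 := hz.2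
    have hw := hwedge hb
    -- If the contraction of z is ∂b, adding ∂(g ∧ b) to z removes all simplices through g. The sum
    -- is a cycle in the deletion, which is a cone.
    have h0 : contract R g (z + boundaryMap R (wedge R g b)) = 0 := by
      rw [map_add, ← neg_neg (contract R g (boundaryMap R _)), ← boundaryMap_contract,
        contract_wedge R (hnot _) hb, hbz, add_neg_cancel]
    have hmem : z + boundaryMap R (wedge R g b) ∈ X.boundaries R (m + 1) := by
      refine mem_boundaries_of_cone R hgy hcone (mem_supported_of_contract_eq_zero R
        (Submodule.add_mem _ hz.1 (boundaryMap_mem_chains R X hw)) h0) ?_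
      rw [map_add, hz2, boundaryMap_boundaryMap, add_zero]
    have hmem2 : boundaryMap R (wedge R g b) ∈ X.boundaries R (m + 1) := ⟨_, hw, rfl⟩
    simpa using Submodule.sub_mem _ hmem hmem2
  · intro z hz
    have hz2 : boundaryMap R z = 0 := hz.2
    have hdel : z ∈ Finsupp.supported R R {σ | (σ ∈ X ∧ #σ = m) ∧ g ∉ σ} := fun σ hσ =>
      ⟨⟨X.down_closed _ (mem_link.1 (hz.1 hσ).1).2 _ subset_union_right, (hz.1 hσ).2⟩,
        hnot m σ (hz.1 hσ)⟩
    have hy := wedge_mem_supported_of_cone R hgy hcone hdel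
    -- The suspension of z: both cones have boundary z, and y ∧ z avoids g, so contraction returns
    -- z.
    refine ⟨wedge R g z - wedge R y z,
      ⟨Submodule.sub_mem _ (hwedge hz.1) fun σ hσ => (hy hσ).1, ?_⟩, ?_⟩
    · change boundaryMap R _ = 0
      rw [map_sub, boundaryMap_wedge, boundaryMap_wedge, hz2, map_zero, map_zero, sub_self]
    · rw [map_sub, contract_wedge R (hnot m) hz.1, contract_eq_zero R (fun σ hσ => hσ.2) hy,
        sub_zero, sub_self]
      exact Submodule.zero_mem _

/-- Index 0 is dimension -1, not reached by the suspension isomorphism: multiples of ∅ avoid g, so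
they bound in the cone. -/
theorem subsingleton_reducedHomology_zero {X : SimpComplex V} {g y : V} (hgy : y ≠ g)
    (hcone : ∀ σ ∈ X, g ∉ σ → insert y σ ∈ X) : Subsingleton (X.reducedHomology R 0) := by
  refine subsingleton_reducedHomology_of_le R fun z hz =>
    mem_boundaries_of_cone R hgy hcone (fun σ hσ => ⟨hz.1 hσ, ?_⟩) hz.2
  rw [card_eq_zero.1 (hz.1 hσ).2]
  exact notMem_empty g

/-! ### Complexes with the homology of a sphere -/

/-- `K` has the reduced homology of a sphere of dimension `n - 1`. -/
def HasSphereHomology (K : SimpComplex V) (n : ℕ) : Prop :=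
  ∀ m : ℕ, (m = n → Nonempty (K.reducedHomology R m ≃ₗ[R] R)) ∧
    (m ≠ n → Subsingleton (K.reducedHomology R m))

variable {R}

theorem HasSphereHomology.of_equiv {K L : SimpComplex V} {n : ℕ} (h : L.HasSphereHomology R n)
    (e : ∀ m, Nonempty (K.reducedHomology R m ≃ₗ[R] L.reducedHomology R m)) :
    K.HasSphereHomology R n := by
  intro m
  obtain ⟨e⟩ := e m
  refine ⟨fun hm => ?_, fun hm => ?_⟩
  · obtain ⟨f⟩ := (h m).1 hm
    exact ⟨e.trans f⟩
  · have := (h m).2 hm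
    exact e.toEquiv.subsingleton

theorem HasSphereHomology.of_link {X : SimpComplex V} {g y : V} (hgy : y ≠ g)
    (hcone : ∀ σ ∈ X, g ∉ σ → insert y σ ∈ X) {n : ℕ}
    (h : (X.link {g}).HasSphereHomology R n) : X.HasSphereHomology R (n + 1) := by
  intro m
  cases m with
  | zero => exact ⟨fun h => by omega, fun _ => subsingleton_reducedHomology_zero R hgy hcone⟩
  | succ m =>
    obtain ⟨e⟩ := nonempty_reducedHomology_equiv_link R hgy hcone m
    refine ⟨fun hm => ?_, fun hm => ?_⟩
    · obtain ⟨f⟩ := (h m).1 (by omega)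
      exact ⟨e.trans f⟩
    · have := (h m).2 (by omega)
      exact e.toEquiv.subsingleton

theorem mem_join_boundaryComplex {L : SimpComplex V} {G σ : Finset V}
    (hG : ∀ τ ∈ L, Disjoint G τ) :
    σ ∈ join (boundaryComplex G) L ↔ σ \ G ∈ L ∧ ¬ G ⊆ σ := by
  change σ ∈ image₂ _ _ _ ↔ _
  rw [mem_image₂]
  constructor
  · rintro ⟨a, ha, b, hb, rfl⟩
    have ha' : a ⊂ G := mem_ssubsets.1 ha
    have hb' := hG b hb
    refine ⟨?_, fun h => ha'.2 ?_⟩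
    · rw [union_sdiff_distrib, sdiff_eq_empty_iff_subset.2 ha'.1, empty_union,
        sdiff_eq_self_of_disjoint hb'.symm]
      exact hb
    · exact hb'.left_le_of_le_sup_right h
  · rintro ⟨h, hG'⟩
    refine ⟨σ ∩ G, mem_ssubsets.2 ⟨inter_subset_right, fun h' => hG' ?_⟩, σ \ G, h, ?_⟩
    · exact h'.trans inter_subset_left
    · rw [union_comm, sdiff_union_inter]

/-- Each vertex of G beyond the first suspends once. For G ∪ {g}, a face avoiding g cannot be
completed to contain all of G ∪ {g} by adding y ∈ G, so the deletion of g is a cone over y; the link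
of g is ∂G * L. -/
theorem HasSphereHomology.join_boundaryComplex {L : SimpComplex V} {n : ℕ}
    (h : L.HasSphereHomology R n) (G : Finset V) (hG0 : G.Nonempty)
    (hG : ∀ τ ∈ L, Disjoint G τ) :
    (join (boundaryComplex G) L).HasSphereHomology R (n + (#G - 1)) := by
  induction hG0 using Finset.Nonempty.cons_induction with
  | singleton g =>
    have : join (boundaryComplex {g}) L = L := by
      ext σ
      change σ ∈ join (boundaryComplex {g}) L ↔ σ ∈ L
      rw [mem_join_boundaryComplex hG, singleton_subset_iff]
      refine ⟨fun h => ?_, fun h => ?_⟩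
      · rw [sdiff_singleton_eq_erase, erase_eq_of_notMem h.2] at h
        exact h.1
      · have := disjoint_singleton_left.1 (hG σ h)
        rw [sdiff_singleton_eq_erase, erase_eq_of_notMem this]
        exact ⟨h, this⟩
    rw [this]
    exact h
  | cons g G hg hG0 ih =>
    obtain ⟨y, hy⟩ := hG0
    rw [cons_eq_insert] at hG ⊢
    have hG' : ∀ τ ∈ L, Disjoint G τ := fun τ hτ => (hG τ hτ).mono_left (subset_insert g G)
    have hpos : 0 < #G := card_pos.2 ⟨y, hy⟩
    have hcard : n + (#(insert g G) - 1) = n + (#G - 1) + 1 := by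
      rw [card_insert_of_notMem hg]; omega
    rw [hcard]
    refine HasSphereHomology.of_link (g := g) (y := y) (fun e => hg (e ▸ hy)) ?_ ?_
    · intro σ hσ hgσ
      rw [mem_join_boundaryComplex hG] at hσ ⊢
      refine ⟨?_, fun h => ?_⟩
      · rw [insert_sdiff_of_mem _ (mem_insert_of_mem hy)]
        exact hσ.1
      · rcases mem_insert.1 (h (mem_insert_self g G)) with e | e
        · exact hg (e ▸ hy)
        · exact hgσ e
    · convert ih hG' using 1
      ext σ
      change σ ∈ link _ _ ↔ σ ∈ join _ _
      rw [mem_link, disjoint_singleton_left, mem_join_boundaryComplex hG,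
        mem_join_boundaryComplex hG', ← insert_eq,
        insert_sdiff_of_mem _ (mem_insert_self g G)]
      have key (hgσ : g ∉ σ) : σ \ insert g G = σ \ G ∧ (insert g G ⊆ insert g σ ↔ G ⊆ σ) := by
        refine ⟨by rw [sdiff_insert, erase_eq_of_notMem (fun h => hgσ (mem_sdiff.1 h).1)],
          insert_subset_insert_iff hg⟩
      constructor
      · rintro ⟨hgσ, h⟩
        rwa [(key hgσ).1, (key hgσ).2] at h
      · intro h
        have hgσ : g ∉ σ := fun hgσ => disjoint_left.1 (hG _ h.1) (mem_insert_self g G)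
          (mem_sdiff.2 ⟨hgσ, hg⟩)
        rw [(key hgσ).1, (key hgσ).2]
        exact ⟨hgσ, h⟩

end Homology
end SimpComplex
end

noncomputable section

namespace SimpComplex

/-! ### Faces, size and missing faces -/

section Basic

variable {V : Type*} {K : SimpComplex V}

theorem ext_mem {L : SimpComplex V} (h : ∀ σ, σ ∈ K ↔ σ ∈ L) : K = L :=
  SimpComplex.ext (Finset.ext h)

theorem notMem_of_singleton_notMem {v : V} (hv : {v} ∉ K) {σ : Finset V}
    (hσ : σ ∈ K) : v ∉ σ :=
  fun h => hv (K.down_closed _ hσ _ (singleton_subset_iff.2 h))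

theorem card_le_size {σ : Finset V} (h : σ ∈ K) : #σ ≤ K.size := Finset.le_sup h

theorem exists_mem_card_eq_size (h : K.faces.Nonempty) : ∃ σ ∈ K, #σ = K.size := by
  obtain ⟨σ, hσ, e⟩ := Finset.exists_mem_eq_sup K.faces h Finset.card
  exact ⟨σ, hσ, e.symm⟩

theorem exists_isMissingFace_subset {N : Finset V} (hN : N ∉ K) :
    ∃ M ⊆ N, K.IsMissingFace M := by
  induction N using Finset.strongInduction with
  | _ N ih =>
    by_cases h : ∀ τ, τ ⊂ N → τ ∈ K
    · exact ⟨N, subset_rfl, hN, h⟩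
    · push Not at h
      obtain ⟨τ, hτ, hτK⟩ := h
      obtain ⟨M, hM, hM'⟩ := ih τ hτ hτK
      exact ⟨M, hM.trans hτ.1, hM'⟩

end Basic

/-! ### Stellar subdivisions and their links -/

section Stellar

variable {V : Type*} [LinearOrder V]

theorem link_link {K : SimpComplex V} {σ τ : Finset V} (h : Disjoint σ τ) :
    (K.link σ).link τ = K.link (σ ∪ τ) := by
  refine ext_mem fun ρ => ?_
  simp only [mem_link, disjoint_union_left, disjoint_union_right, union_assoc]
  tauto

theorem link_singleton_notMem {K : SimpComplex V} {v : V} (hv : {v} ∉ K) (σ : Finset V) :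
    {v} ∉ K.link σ := fun h => hv (K.down_closed _ (mem_link.1 h).2 _ subset_union_right)

/-- The complex `K ∪ {v} * F * lk_K(F)`, which contains both `K` and its stellar subdivision. -/
def coneStar (K : SimpComplex V) (F : Finset V) (v : V) : SimpComplex V where
  faces := K.faces ∪ {τ ∈ K.faces | τ ∪ F ∈ K.faces}.image (insert v)
  down_closed := by
    intro σ hσ τ hτ
    rw [mem_union, mem_image] at hσ ⊢
    rcases hσ with hσ | ⟨ρ, hρ, rfl⟩
    · exact Or.inl (K.down_closed σ hσ τ hτ)
    · rw [mem_filter] at hρ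
      have hsub : τ.erase v ⊆ ρ := subset_insert_iff.1 hτ
      by_cases hv : v ∈ τ
      · refine Or.inr ⟨τ.erase v, mem_filter.2 ⟨K.down_closed _ hρ.1 _ hsub,
          K.down_closed _ hρ.2 _ (union_subset_union_left hsub)⟩, insert_erase hv⟩
      · rw [erase_eq_of_notMem hv] at hsub
        exact Or.inl (K.down_closed _ hρ.1 _ hsub)

variable {K : SimpComplex V} {F : Finset V} {v : V}

theorem mem_coneStar (hv : {v} ∉ K) {σ : Finset V} :
    σ ∈ K.coneStar F v ↔ σ ∈ K ∨ (v ∈ σ ∧ σ.erase v ∪ F ∈ K) := by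
  change σ ∈ K.faces ∪ _ ↔ _
  rw [mem_union, mem_image]
  refine or_congr Iff.rfl ⟨?_, fun h => ?_⟩
  · rintro ⟨ρ, hρ, rfl⟩
    rw [mem_filter] at hρ
    rw [erase_insert (notMem_of_singleton_notMem hv hρ.1)]
    exact ⟨mem_insert_self v ρ, hρ.2⟩
  · exact ⟨σ.erase v, mem_filter.2 ⟨K.down_closed _ h.2 _ subset_union_left, h.2⟩,
      insert_erase h.1⟩

/-- In this form the subdivision consists of the faces of `coneStar` that do not contain F. -/
theorem mem_stellar (hF : F ∈ K) (hv : {v} ∉ K) {σ : Finset V} :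
    σ ∈ K.stellar F v ↔ ¬ F ⊆ σ ∧ (σ ∈ K ∨ (v ∈ σ ∧ σ.erase v ∪ F ∈ K)) := by
  have hvF := notMem_of_singleton_notMem hv hF
  have hdis : ∀ τ ∈ K.link F, Disjoint F τ := fun τ hτ => (mem_link.1 hτ).1
  have hJ (b : Finset V) :
      b ∈ join (boundaryComplex F) (K.link F) ↔ b ∪ F ∈ K ∧ ¬ F ⊆ b := by
    rw [mem_join_boundaryComplex hdis, mem_link, union_sdiff_self_eq_union, union_comm]
    simp only [disjoint_sdiff, true_and]
  change σ ∈ _ ∪ image₂ _ _ _ ↔ _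
  rw [mem_union, mem_filter, mem_image₂]
  constructor
  · rintro (h | ⟨a, ha, b, hb, rfl⟩)
    · exact ⟨h.2, Or.inl h.1⟩
    · have hb' := (hJ b).1 hb
      have hbK : b ∈ K := K.down_closed _ hb'.1 _ subset_union_left
      have hvb := notMem_of_singleton_notMem hv hbK
      rcases subset_singleton_iff.1 (mem_powerset.1 ha) with rfl | rfl
      · rw [empty_union]
        exact ⟨hb'.2, Or.inl hbK⟩
      · rw [← insert_eq, erase_insert hvb]
        refine ⟨fun h => hb'.2 ((subset_insert_iff_of_notMem hvF).1 h),
          Or.inr ⟨mem_insert_self v b, hb'.1⟩⟩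
  · rintro ⟨h, h' | ⟨hvσ, h'⟩⟩
    · exact Or.inl ⟨h', h⟩
    · refine Or.inr ⟨{v}, mem_powerset.2 subset_rfl, σ.erase v, (hJ _).2 ⟨h', fun h'' => ?_⟩, ?_⟩
      · exact h (h''.trans (erase_subset v σ))
      · rw [← insert_eq, insert_erase hvσ]

theorem link_stellar_of_union_notMem (hF : F ∈ K) (hv : {v} ∉ K) {T : Finset V}
    (hT : T ∪ F ∉ K) (hvT : v ∉ T) : (K.stellar F v).link T = K.link T := by
  refine ext_mem fun σ => ?_
  rw [mem_link, mem_link, mem_stellar hF hv]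
  refine and_congr_right fun _ => ⟨?_, fun h => ⟨fun h' => hT ?_, Or.inl h⟩⟩
  · rintro ⟨-, h | ⟨-, h⟩⟩
    · exact h
    · refine absurd (K.down_closed _ h _ (union_subset_union_left ?_)) hT
      exact subset_erase.2 ⟨subset_union_left, hvT⟩
  · exact K.down_closed _ h _ (union_subset subset_union_left h')

theorem sdiff_mem_link {T : Finset V} (hT : T ∪ F ∈ K) : F \ T ∈ K.link T :=
  mem_link.2 ⟨disjoint_sdiff, by rwa [union_sdiff_self_eq_union]⟩

/-- The case F ⊆ T is harmless: T is then no face of the subdivision, and both sides are void. -/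
theorem link_stellar_of_union_mem (hF : F ∈ K) (hv : {v} ∉ K) {T : Finset V}
    (hT : T ∪ F ∈ K) :
    (K.stellar F v).link T = (K.link T).stellar (F \ T) v := by
  have hvT : v ∉ T := fun h => notMem_of_singleton_notMem hv hT (mem_union_left F h)
  have hvF := notMem_of_singleton_notMem hv hF
  refine ext_mem fun σ => ?_
  rw [mem_link, mem_stellar hF hv,
    mem_stellar (sdiff_mem_link hT) (link_singleton_notMem hv T), mem_link, mem_link]
  have e1 : F \ T ⊆ σ ↔ F ⊆ T ∪ σ := sdiff_le_iff
  have e2 : T ∪ (σ.erase v ∪ F \ T) = (T ∪ σ).erase v ∪ F := by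
    rw [erase_union_distrib, erase_eq_of_notMem hvT, union_left_comm, union_sdiff_self_eq_union,
      union_left_comm, ← union_assoc]
  have e3 : v ∈ T ∪ σ ↔ v ∈ σ := by simp [hvT]
  have e4 : Disjoint T (σ.erase v ∪ F \ T) ↔ Disjoint T σ := by
    rw [disjoint_union_right, and_iff_left disjoint_sdiff, ← disjoint_erase_comm,
      erase_eq_of_notMem hvT]
  rw [e1, e2, e3, e4]
  tauto

theorem link_stellar_singleton (hF : F ∈ K) (hv : {v} ∉ K) :
    (K.stellar F v).link {v} = join (boundaryComplex F) (K.link F) := by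
  have hvF := notMem_of_singleton_notMem hv hF
  refine ext_mem fun σ => ?_
  rw [mem_link, disjoint_singleton_left, mem_stellar hF hv, ← insert_eq,
    mem_join_boundaryComplex (fun τ hτ => (mem_link.1 hτ).1), mem_link,
    union_sdiff_self_eq_union, union_comm F, subset_insert_iff_of_notMem hvF]
  constructor
  · rintro ⟨hvσ, h, h' | ⟨-, h'⟩⟩
    · exact absurd (mem_insert_self v σ) (notMem_of_singleton_notMem hv h')
    · rw [erase_insert hvσ] at h'
      exact ⟨⟨disjoint_sdiff, h'⟩, h⟩
  · rintro ⟨⟨-, h'⟩, h⟩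
    have hvσ : v ∉ σ := fun e => notMem_of_singleton_notMem hv h' (mem_union_left F e)
    exact ⟨hvσ, h, Or.inr ⟨mem_insert_self v σ, by rwa [erase_insert hvσ]⟩⟩

/-- Both complexes are compared with `coneStar`. Its faces outside the subdivision are those
containing F, and they are paired by toggling v ∉ F. Its faces outside K are those containing v, and
they are paired by toggling a vertex f of F. -/
theorem nonempty_reducedHomology_stellar_equiv (R : Type*) [CommRing R] (hF : F ∈ K)
    (hF0 : F.Nonempty) (hv : {v} ∉ K) (m : ℕ) :
    Nonempty ((K.stellar F v).reducedHomology R m ≃ₗ[R] K.reducedHomology R m) := by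
  have hvF := notMem_of_singleton_notMem hv hF
  obtain ⟨f, hf⟩ := hF0
  have hfv : f ≠ v := fun e => hvF (e ▸ hf)
  have e1 : Nonempty ((K.stellar F v).reducedHomology R m ≃ₗ[R]
      (K.coneStar F v).reducedHomology R m) := by
    refine nonempty_reducedHomology_equiv_of_toggle R v (fun σ hσ => ?_) (fun σ hσ => ?_) m
    · exact (mem_coneStar hv).2 ((mem_stellar hF hv).1 hσ).2
    · rw [mem_stellar hF hv, mem_stellar hF hv, mem_coneStar hv, mem_coneStar hv,
        subset_insert_iff_of_notMem hvF, erase_insert hσ]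
      have h1 : insert v σ ∉ K := fun h => notMem_of_singleton_notMem hv h (mem_insert_self v σ)
      have h2 : F ⊆ σ → (σ ∪ F ∈ K ↔ σ ∈ K) := fun h => by rw [union_eq_left.2 h]
      have h3 := mem_insert_self v σ
      tauto
  have e2 : Nonempty (K.reducedHomology R m ≃ₗ[R] (K.coneStar F v).reducedHomology R m) := by
    refine nonempty_reducedHomology_equiv_of_toggle R f (fun σ hσ => ?_) (fun σ hσ => ?_) m
    · exact (mem_coneStar hv).2 (Or.inl hσ)
    · rw [mem_coneStar hv, mem_coneStar hv, erase_insert_of_ne hfv, insert_union,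
        insert_eq_of_mem (mem_union_right _ hf)]
      have h1 : v ∈ insert f σ ↔ v ∈ σ := by simp [hfv.symm]
      have h2 : σ ∈ K → v ∉ σ := notMem_of_singleton_notMem hv
      have h3 : insert f σ ∈ K → v ∉ insert f σ := notMem_of_singleton_notMem hv
      tauto
  obtain ⟨e1⟩ := e1
  obtain ⟨e2⟩ := e2
  exact ⟨e1.trans e2.symm⟩

end Stellar

/-! ### Homology spheres -/

section Sphere

variable {V : Type*} [LinearOrder V] {R : Type*} [CommRing R] {K : SimpComplex V} {d : ℕ}

theorem isHomologySphere_iff : K.IsHomologySphere R d ↔ K.faces.Nonempty ∧ K.size = d ∧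
    ∀ σ ∈ K, (K.link σ).HasSphereHomology R (d - #σ) := by
  unfold IsHomologySphere HasSphereHomology
  refine and_congr_right fun _ => and_congr_right fun hd => ?_
  refine forall₂_congr fun σ hσ => forall_congr' fun m => ?_
  have : #σ ≤ d := hd ▸ card_le_size hσ
  have e : m + #σ = d ↔ m = d - #σ := by omega
  rw [ne_eq, ne_eq, e]

theorem exists_mem_card_of_hasSphereHomology [Nontrivial R] {n : ℕ}
    (h : K.HasSphereHomology R n) : ∃ σ ∈ K, #σ = n := by
  by_contra! hn
  have hch : K.chains R n = ⊥ := by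
    rw [chains, show {σ | σ ∈ K ∧ #σ = n} = ∅ from
      Set.eq_empty_of_forall_notMem fun σ hσ => hn σ hσ.1 hσ.2]
    exact Finsupp.supported_empty
  have hs : Subsingleton (K.reducedHomology R n) := by
    refine subsingleton_reducedHomology_of_le R fun z hz => ?_
    have hz1 := hz.1
    rw [hch] at hz1
    have : z = 0 := hz1
    rw [this]
    exact Submodule.zero_mem _
  obtain ⟨e⟩ := (h n).1 rfl
  exact not_subsingleton R e.symm.toEquiv.subsingleton

/-- The definition prescribes only the homology of links, not their dimension. Cardinality bounds
the dimension above, and nonzero top homology forces a face of the required size. -/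
theorem IsHomologySphere.link [Nontrivial R] (hK : K.IsHomologySphere R d) {F : Finset V}
    (hF : F ∈ K) : (K.link F).IsHomologySphere R (d - #F) := by
  rw [isHomologySphere_iff] at hK ⊢
  obtain ⟨hne, hd, h⟩ := hK
  obtain ⟨τ, hτ, hτc⟩ := exists_mem_card_of_hasSphereHomology (h F hF)
  refine ⟨⟨τ, hτ⟩, le_antisymm (Finset.sup_le fun σ hσ => ?_) (hτc ▸ card_le_size hτ),
    fun σ hσ => ?_⟩
  · have hσ' := mem_link.1 (show σ ∈ K.link F from hσ)
    have := card_le_size hσ'.2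
    rw [card_union_of_disjoint hσ'.1, hd] at this
    omega
  · have hσ' := mem_link.1 hσ
    rw [link_link hσ'.1]
    have := h _ hσ'.2
    rwa [card_union_of_disjoint hσ'.1, ← Nat.sub_sub] at this

theorem IsHomologySphere.stellar (hK : K.IsHomologySphere R d) {F : Finset V}
    (hF : F ∈ K) (hF0 : F.Nonempty) {v : V} (hv : {v} ∉ K) :
    (K.stellar F v).IsHomologySphere R d := by
  have hvF := notMem_of_singleton_notMem hv hF
  rw [isHomologySphere_iff] at hK ⊢
  obtain ⟨hne, hd, h⟩ := hK
  have hle : ∀ σ ∈ K.stellar F v, #σ ≤ d := by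
    intro σ hσ
    rw [mem_stellar hF hv] at hσ
    rcases hσ with ⟨hFσ, hσ | ⟨hvσ, hσ⟩⟩
    · exact hd ▸ card_le_size hσ
    · have hlt : #(σ.erase v) < #(σ.erase v ∪ F) := by
        refine card_lt_card ⟨subset_union_left, fun h => hFσ ?_⟩
        exact (subset_union_right.trans h).trans (erase_subset v σ)
      have := card_le_size hσ
      have := card_erase_add_one hvσ
      omega
  -- A facet of K survives unless it contains F; then one vertex f of F is exchanged for v.
  have hex : ∃ σ ∈ K.stellar F v, #σ = d := by
    obtain ⟨τ, hτ, hτd⟩ := exists_mem_card_eq_size hne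
    have hvτ := notMem_of_singleton_notMem hv hτ
    by_cases hFτ : F ⊆ τ
    · obtain ⟨f, hf⟩ := hF0
      have hvf : v ∉ τ.erase f := fun h => hvτ (mem_of_mem_erase h)
      refine ⟨insert v (τ.erase f), (mem_stellar hF hv).2 ⟨fun h => ?_, Or.inr
        ⟨mem_insert_self _ _, ?_⟩⟩, ?_⟩
      · exact notMem_erase f τ ((subset_insert_iff_of_notMem hvF).1 h hf)
      · rw [erase_insert hvf]
        exact K.down_closed _ hτ _ (union_subset (erase_subset f τ) hFτ)
      · rw [card_insert_of_notMem hvf, card_erase_add_one (hFτ hf), hτd, hd]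
    · exact ⟨τ, (mem_stellar hF hv).2 ⟨hFτ, Or.inl hτ⟩, hτd.trans hd⟩
  obtain ⟨σ₀, hσ₀, hc₀⟩ := hex
  -- links of faces without the new vertex
  have hA : ∀ T, v ∉ T → T ∈ K.stellar F v →
      ((K.stellar F v).link T).HasSphereHomology R (d - #T) := by
    intro T hvT hT
    rw [mem_stellar hF hv] at hT
    have hTK : T ∈ K := by tauto
    by_cases hTF : T ∪ F ∈ K
    · rw [link_stellar_of_union_mem hF hv hTF]
      exact (h T hTK).of_equiv (nonempty_reducedHomology_stellar_equiv R (sdiff_mem_link hTF)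
        (sdiff_nonempty.2 hT.1) (link_singleton_notMem hv T))
    · rw [link_stellar_of_union_notMem hF hv hTF hvT]
      exact h T hTK
  refine ⟨⟨σ₀, hσ₀⟩, le_antisymm (Finset.sup_le hle) (hc₀ ▸ card_le_size hσ₀), fun T hT => ?_⟩
  by_cases hvT : v ∈ T
  · have hT' := (mem_stellar hF hv).1 hT
    have hTK : T ∉ K := fun h => notMem_of_singleton_notMem hv h hvT
    have hAF : T.erase v ∪ F ∈ K := by tauto
    -- With A = T \ {v}, pass to the link of A, which is subdivided at F \ A, and then to the link
    -- of the new vertex. The index matches because (d - |A ∪ F|) + (|F \ A| - 1) = d - |T|.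
    have hlink : (K.stellar F v).link T
        = join (boundaryComplex (F \ T.erase v)) (K.link (T.erase v ∪ F)) := by
      conv_lhs => rw [← insert_erase hvT, insert_eq, union_comm]
      rw [← link_link (disjoint_singleton_right.2 (notMem_erase v T)),
        link_stellar_of_union_mem hF hv hAF, link_stellar_singleton (sdiff_mem_link hAF)
        (link_singleton_notMem hv _), link_link disjoint_sdiff, union_sdiff_self_eq_union]
    have hne : (F \ T.erase v).Nonempty :=
      sdiff_nonempty.2 fun h => hT'.1 (h.trans (erase_subset v T))
    rw [hlink]
    convert (h _ hAF).join_boundaryComplex (F \ T.erase v) hne (fun τ hτ =>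
      (mem_link.1 hτ).1.mono_left (sdiff_subset.trans subset_union_right)) using 1
    have h1 := card_union_of_disjoint (disjoint_sdiff : Disjoint (T.erase v) (F \ T.erase v))
    rw [union_sdiff_self_eq_union] at h1
    have h2 := card_erase_add_one hvT
    have h3 := card_pos.2 hne
    have h4 := card_le_size hAF
    omega
  · exact hA T hvT hT

/-! ### Missing faces -/

/-- If `M ∪ F` is not a face, but `τ ∪ F` is a face for all proper subsets `τ` of `M`, then `M` is
contained in a missing face of `K`. -/
theorem exists_isMissingFace_of_union {M F : Finset V} (h : M ∪ F ∉ K)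
    (h' : ∀ τ, τ ⊂ M → τ ∪ F ∈ K) : ∃ N, M ⊆ N ∧ N ⊆ M ∪ F ∧ K.IsMissingFace N := by
  obtain ⟨N, hN, hN'⟩ := exists_isMissingFace_subset h
  refine ⟨N, ?_, hN, hN'⟩
  by_contra hMN
  -- If M ⊄ N, then M ∩ N is a proper subset of M, and N lies in the face (M ∩ N) ∪ F.
  refine hN'.1 (K.down_closed _ (h' (M ∩ N) ⟨inter_subset_left, fun e => hMN ?_⟩) _ ?_)
  · exact e.trans inter_subset_right
  · intro x hx
    rcases mem_union.1 (hN hx) with h | h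
    · exact mem_union_left _ (mem_inter.2 ⟨h, hx⟩)
    · exact mem_union_right _ h

theorem card_le_of_isMissingFace_link {i : ℕ} (hi : ∀ M, K.IsMissingFace M → #M ≤ i + 1)
    {F M : Finset V} (hM : (K.link F).IsMissingFace M) : #M ≤ i + 1 := by
  -- Singletons are set aside because a vertex of F is itself a missing face of the link; larger
  -- missing faces are disjoint from F.
  by_cases h1 : #M ≤ 1
  · omega
  have hdis : Disjoint F M := by
    rw [disjoint_right]
    intro x hx
    have : ({x} : Finset V) ⊂ M := by
      refine (singleton_subset_iff.2 hx).ssubset_of_ne fun e => h1 ?_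
      rw [← e, card_singleton]
    exact disjoint_singleton_right.1 (mem_link.1 (hM.2 _ this)).1
  have hMF : M ∪ F ∉ K := fun h => hM.1 (mem_link.2 ⟨hdis, by rwa [union_comm]⟩)
  obtain ⟨N, hMN, -, hN⟩ := exists_isMissingFace_of_union hMF fun τ hτ => by
    rw [union_comm]; exact (mem_link.1 (hM.2 τ hτ)).2
  exact (card_le_card hMN).trans (hi N hN)

/-- If v ∈ M, then M \ {v} is a face of K properly contained in a missing face of K, which makes up
for the extra vertex v. If v ∉ M, then M is missing in K already or M = F. -/
theorem card_le_of_isMissingFace_stellar {i : ℕ} (hi : ∀ M, K.IsMissingFace M → #M ≤ i + 1)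
    {F : Finset V} (hF : F ∈ K) (hFi : #F ≤ i + 1) {v : V} (hv : {v} ∉ K)
    {M : Finset V} (hM : (K.stellar F v).IsMissingFace M) : #M ≤ i + 1 := by
  have hvF := notMem_of_singleton_notMem hv hF
  obtain ⟨hM1, hM2⟩ := hM
  by_cases hvM : v ∈ M
  · set N := M.erase v with hN
    have hcard : #N + 1 = #M := card_erase_add_one hvM
    have hvN : v ∉ N := notMem_erase v M
    have hNM : insert v N = M := insert_erase hvM
    have hNS := (mem_stellar hF hv).1 (hM2 N (erase_ssubset hvM))
    have hNK : N ∈ K := by tauto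
    have hFM : ¬ F ⊆ M := fun h => hNS.1 ((subset_insert_iff_of_notMem hvF).1 (hNM ▸ h))
    have hNF : N ∪ F ∉ K := fun h =>
      hM1 ((mem_stellar hF hv).2 ⟨hFM, Or.inr ⟨hvM, h⟩⟩)
    obtain ⟨L, hNL, -, hL⟩ := exists_isMissingFace_of_union hNF fun τ hτ => by
      have hvτ : v ∉ τ := fun h => hvN (hτ.1 h)
      have hss : insert v τ ⊂ M := by
        rw [← hNM]
        exact ⟨insert_subset_insert v hτ.1, fun h => hτ.2 ((insert_subset_insert_iff hvN).1 h)⟩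
      have := (mem_stellar hF hv).1 (hM2 _ hss)
      rw [erase_insert hvτ] at this
      rcases this.2 with h | h
      · exact absurd (mem_insert_self v τ) (notMem_of_singleton_notMem hv h)
      · exact h.2
    have hlt : #N < #L := card_lt_card ⟨hNL, fun h => hL.1 (K.down_closed _ hNK _ h)⟩
    have := hi L hL
    omega
  · have hsub : ∀ τ, τ ⊂ M → τ ∈ K := fun τ hτ => by
      have := (mem_stellar hF hv).1 (hM2 τ hτ)
      have hvτ : v ∉ τ := fun h => hvM (hτ.1 h)
      tauto
    by_cases hMK : M ∈ K
    · have hFM : F ⊆ M := by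
        by_contra h
        exact hM1 ((mem_stellar hF hv).2 ⟨h, Or.inl hMK⟩)
      have : F = M := by
        by_contra hne
        exact ((mem_stellar hF hv).1 (hM2 F (hFM.ssubset_of_ne hne))).1 subset_rfl
      rwa [← this]
    · exact hi M ⟨hMK, hsub⟩

end Sphere

end SimpComplex
end

noncomputable section

namespace SimpComplex

/-! ### The Euler characteristic -/

section Euler

/-- Over a domain that need not be Noetherian, submodules of finite modules need not be finitely
generated. Finite rank does pass to submodules, so it is the hypothesis used. -/
theorem finrank_range_add_finrank_ker_of_rank_lt {R : Type*} [CommRing R] [IsDomain R]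
    {M N : Type*} [AddCommGroup M] [Module R M] [AddCommGroup N] [Module R N]
    (hM : Module.rank R M < Cardinal.aleph0) (f : M →ₗ[R] N) :
    Module.finrank R (LinearMap.range f) + Module.finrank R (LinearMap.ker f)
      = Module.finrank R M := by
  have h := HasRankNullity.rank_quotient_add_rank (LinearMap.ker f)
  have h1 : Module.rank R (M ⧸ LinearMap.ker f) < Cardinal.aleph0 :=
    lt_of_le_of_lt (by rw [← h]; exact self_le_add_right _ _) hM
  have h2 : Module.rank R (LinearMap.ker f) < Cardinal.aleph0 :=
    lt_of_le_of_lt (by rw [← h]; exact self_le_add_left _ _) hM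
  rw [← f.quotKerEquivRange.finrank_eq, Module.finrank, Module.finrank, Module.finrank,
    ← Cardinal.toNat_add h1 h2, h]

theorem finrank_map_add_finrank_inf_ker {R : Type*} [CommRing R] [IsDomain R]
    {M N : Type*} [AddCommGroup M] [Module R M] [AddCommGroup N] [Module R N]
    (Z : Submodule R M) (hZ : Module.rank R Z < Cardinal.aleph0) (f : M →ₗ[R] N) :
    Module.finrank R (Z.map f) + Module.finrank R ↥(Z ⊓ LinearMap.ker f)
      = Module.finrank R Z := by
  have h := finrank_range_add_finrank_ker_of_rank_lt hZ (f.domRestrict Z)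
  rwa [LinearMap.range_domRestrict, LinearMap.ker_domRestrict,
    LinearEquiv.finrank_eq (Submodule.equivSubtypeMap _ _), Submodule.map_comap_subtype] at h

variable {V : Type*} [LinearOrder V] (R : Type*) [CommRing R] [IsDomain R]

theorem finrank_chains {V : Type*} (R : Type*) [CommRing R] [IsDomain R] (K : SimpComplex V)
    (m : ℕ) :
    Module.finrank R (K.chains R m) = K.fNum m ∧
      Module.rank R (K.chains R m) < Cardinal.aleph0 := by
  classical
  have hs : {σ | σ ∈ K ∧ #σ = m} = (↑({σ ∈ K.faces | #σ = m} : Finset (Finset V)) : Set _) := by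
    ext σ
    rw [mem_coe, mem_filter]
    rfl
  let e : K.chains R m ≃ₗ[R] (({σ ∈ K.faces | #σ = m} : Finset (Finset V)) →₀ R) :=
    (LinearEquiv.ofEq _ _ (by rw [chains, hs])).trans (Finsupp.supportedEquivFinsupp _)
  constructor
  · rw [e.finrank_eq, Module.finrank_finsupp_self, Fintype.card_coe, fNum]
  · have : Module.Finite R (K.chains R m) := Module.Finite.equiv e.symm
    exact Module.rank_lt_aleph0 R _

theorem finrank_cycles_zero (K : SimpComplex V) :
    Module.finrank R (K.cycles R 0) = K.fNum 0 := by
  have h : K.cycles R 0 = K.chains R 0 := by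
    refine inf_eq_left.2 fun c hc => ?_
    refine (Submodule.mem_bot R).1
      (map_mem_of_mem_supported (boundaryMap R) (fun σ hσ r => ?_) hc)
    rw [boundaryMap_single, card_eq_zero.1 hσ.2, sum_empty]
    exact Submodule.zero_mem _
  rw [h, (finrank_chains R K 0).1]

theorem finrank_boundaries_add_finrank_cycles (K : SimpComplex V) (m : ℕ) :
    Module.finrank R (K.boundaries R m) + Module.finrank R (K.cycles R (m + 1))
      = K.fNum (m + 1) := by
  rw [← (finrank_chains R K (m + 1)).1]
  exact finrank_map_add_finrank_inf_ker _ (finrank_chains R K (m + 1)).2 _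

theorem finrank_reducedHomology_add (K : SimpComplex V) (m : ℕ) :
    Module.finrank R (K.reducedHomology R m) + Module.finrank R (K.boundaries R m)
      = Module.finrank R (K.cycles R m) := by
  have hrk : Module.rank R (K.cycles R m) < Cardinal.aleph0 :=
    lt_of_le_of_lt (Submodule.rank_mono inf_le_left) (finrank_chains R K m).2
  have h := finrank_map_add_finrank_inf_ker _ hrk (K.boundaries R m).mkQ
  rwa [Submodule.ker_mkQ, inf_eq_right.2 (boundaries_le_cycles R K m)] at h

/-- The Euler-Poincaré formula truncated at N. Rank-nullity telescopes, leaving the rank of the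
boundaries in the last degree, which vanishes for N = `K.size`. -/
theorem sum_fNum_eq_sum_finrank (K : SimpComplex V) (N : ℕ) :
    ∑ m ∈ range (N + 1), (-1 : ℤ) ^ m * K.fNum m =
      ∑ m ∈ range (N + 1), (-1 : ℤ) ^ m * Module.finrank R (K.reducedHomology R m) +
        (-1) ^ N * Module.finrank R (K.boundaries R N) := by
  induction N with
  | zero =>
    have h1 := finrank_cycles_zero R K
    have h2 := finrank_reducedHomology_add R K 0
    simp only [zero_add, sum_range_one, pow_zero, one_mul]
    omega
  | succ N ih =>
    rw [sum_range_succ, ih, sum_range_succ _ (N + 1),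
      ← finrank_boundaries_add_finrank_cycles R K N, ← finrank_reducedHomology_add R K (N + 1)]
    push_cast
    ring

theorem sum_neg_one_pow_card_eq_sum_fNum {V : Type*} (K : SimpComplex V) :
    ∑ σ ∈ K.faces, (-1 : ℤ) ^ #σ = ∑ m ∈ range (K.size + 1), (-1 : ℤ) ^ m * K.fNum m := by
  rw [← Finset.sum_fiberwise_of_maps_to (t := range (K.size + 1)) (g := Finset.card)
    fun σ hσ => mem_range.2 (Nat.lt_succ_of_le (card_le_size hσ))]
  refine sum_congr rfl fun m _ => ?_
  rw [fNum, Finset.sum_congr rfl fun σ hσ => by rw [(mem_filter.1 hσ).2], sum_const,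
    nsmul_eq_mul, mul_comm]

theorem HasSphereHomology.sum_neg_one_pow_card {R : Type*} [CommRing R] [IsDomain R]
    {K : SimpComplex V} {n : ℕ} (h : K.HasSphereHomology R n) :
    ∑ σ ∈ K.faces, (-1 : ℤ) ^ #σ = (-1) ^ n := by
  have hb : K.boundaries R K.size = ⊥ := by
    have hch : K.chains R (K.size + 1) = ⊥ := by
      rw [chains, show {σ | σ ∈ K ∧ #σ = K.size + 1} = ∅ from
        Set.eq_empty_of_forall_notMem fun σ hσ => by
          have := card_le_size hσ.1
          have := hσ.2
          omega]
      exact Finsupp.supported_empty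
    rw [boundaries, hch, Submodule.map_bot]
  obtain ⟨σ, hσ, hσn⟩ := exists_mem_card_of_hasSphereHomology h
  rw [sum_neg_one_pow_card_eq_sum_fNum, sum_fNum_eq_sum_finrank R, hb, finrank_bot,
    Nat.cast_zero, mul_zero, add_zero, Finset.sum_eq_single n]
  · obtain ⟨e⟩ := (h n).1 rfl
    rw [e.finrank_eq, Module.finrank_self, Nat.cast_one, mul_one]
  · intro m _ hm
    have := (h m).2 hm
    rw [Module.finrank_zero_of_subsingleton, Nat.cast_zero, mul_zero]
  · intro h
    exact absurd (mem_range.2 (Nat.lt_succ_of_le (hσn ▸ card_le_size hσ))) h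

end Euler

/-! ### The `h`-polynomial -/

section HPoly

theorem one_sub_X_pow (N : ℕ) :
    (1 - X : ℤ[X]) ^ N = ∑ k ∈ range (N + 1), C ((-1) ^ k * (N.choose k : ℤ)) * X ^ k := by
  rw [sub_eq_neg_add, add_pow]
  refine sum_congr rfl fun k _ => ?_
  rw [neg_pow]
  simp only [one_pow, mul_one, C_mul, C_pow, C_neg, C_1, map_natCast]
  ring

variable {V : Type*}

theorem hNum_eq_sum (K : SimpComplex V) (m : ℕ) : K.hNum m = ∑ σ ∈ K.faces,
    if #σ ≤ m then (-1 : ℤ) ^ (m - #σ) * ((K.size - #σ).choose (m - #σ) : ℤ) else 0 := by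
  have h (j : ℕ) : (K.fNum j : ℤ) = ∑ σ ∈ K.faces, if j = #σ then 1 else 0 := by
    rw [fNum, card_filter]
    push_cast
    exact sum_congr rfl fun σ _ => by simp only [eq_comm]
  simp only [hNum, h, mul_sum]
  rw [sum_comm]
  refine sum_congr rfl fun σ _ => ?_
  simp only [mul_ite, mul_one, mul_zero]
  rw [Finset.sum_ite_eq']
  simp only [mem_range, Nat.lt_succ_iff]

/-- This makes h additive over faces once the size is fixed, so changes of the complex become
changes of the summation set. -/
theorem hPoly_eq_sum (K : SimpComplex V) :
    K.hPoly = ∑ σ ∈ K.faces, X ^ #σ * (1 - X) ^ (K.size - #σ) := by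
  simp only [hPoly, hNum_eq_sum, map_sum, sum_mul]
  rw [sum_comm]
  refine sum_congr rfl fun σ hσ => ?_
  have hle : #σ ≤ K.size := card_le_size hσ
  rw [show K.size + 1 = #σ + (K.size - #σ + 1) by omega, sum_range_add, sum_eq_zero, zero_add,
    one_sub_X_pow, mul_sum]
  · refine sum_congr rfl fun k _ => ?_
    rw [if_pos (Nat.le_add_right _ _), Nat.add_sub_cancel_left, pow_add, mul_left_comm]
  · intro k hk
    rw [if_neg (by have := mem_range.1 hk; omega), C_0, zero_mul]

theorem natDegree_one_sub_X_pow_le (n : ℕ) : ((1 - X : ℤ[X]) ^ n).natDegree ≤ n := by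
  refine (natDegree_pow_le_of_le (m := 1) n ?_).trans (by rw [mul_one])
  exact (natDegree_sub_le _ _).trans (by simp)

theorem reflect_one_sub_X_pow (n : ℕ) : reflect n ((1 - X : ℤ[X]) ^ n) = (X - 1) ^ n := by
  induction n with
  | zero => simp
  | succ n ih =>
    have h1 : (1 - X : ℤ[X]).natDegree ≤ 1 := by simpa using natDegree_one_sub_X_pow_le 1
    rw [pow_succ, reflect_mul _ _ (natDegree_one_sub_X_pow_le n) h1, ih, pow_succ, reflect_sub,
      reflect_one, reflect_one_X, pow_one]

theorem reflect_finset_sum {ι : Type*} (s : Finset ι) (f : ι → ℤ[X]) (n : ℕ) :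
    reflect n (∑ a ∈ s, f a) = ∑ a ∈ s, reflect n (f a) :=
  map_sum (⟨⟨reflect n, reflect_zero⟩, fun p q => reflect_add p q n⟩ : ℤ[X] →+ ℤ[X]) f s

theorem reflect_hPoly (K : SimpComplex V) :
    reflect K.size K.hPoly = ∑ σ ∈ K.faces, (X - 1) ^ (K.size - #σ) := by
  rw [hPoly_eq_sum, reflect_finset_sum]
  refine sum_congr rfl fun σ hσ => ?_
  have hle : #σ + (K.size - #σ) = K.size := Nat.add_sub_cancel' (card_le_size hσ)
  conv_lhs => rw [← hle]
  rw [Nat.add_sub_cancel_left, reflect_mul _ _ (natDegree_X_pow_le _)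
    (natDegree_one_sub_X_pow_le _), reflect_one_sub_X_pow, reflect_monomial, revAt_le le_rfl,
    Nat.sub_self, pow_zero, one_mul]

theorem natDegree_hPoly_le (K : SimpComplex V) : K.hPoly.natDegree ≤ K.size :=
  natDegree_sum_le_of_forall_le _ _ fun _ hm =>
    (natDegree_C_mul_X_pow_le _ _).trans (Nat.le_of_lt_succ (mem_range.1 hm))

variable [LinearOrder V]

/-- Summation over the faces containing `F` is summation over the link of `F`. -/
theorem sum_filter_subset_eq_sum_link {A : Type*} [AddCommMonoid A] (K : SimpComplex V)
    (F : Finset V) (w : ℕ → A) :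
    ∑ T ∈ K.faces with F ⊆ T, w #T = ∑ B ∈ (K.link F).faces, w (#F + #B) := by
  refine sum_nbij' (fun T => T \ F) (fun B => F ∪ B) ?_ ?_ ?_ ?_ ?_
  · intro T hT
    rw [mem_filter] at hT
    exact mem_link.2 ⟨disjoint_sdiff, by
      rw [union_sdiff_self_eq_union, union_eq_right.2 hT.2]; exact hT.1⟩
  · intro B hB
    exact mem_filter.2 ⟨(mem_link.1 hB).2, subset_union_left⟩
  · intro T hT
    rw [mem_filter] at hT
    rw [union_sdiff_self_eq_union, union_eq_right.2 hT.2]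
  · intro B hB
    exact union_sdiff_cancel_left (mem_link.1 hB).1
  · intro T hT
    rw [mem_filter] at hT
    rw [add_comm, card_sdiff_add_card_eq_card hT.2]

/-- The Dehn-Sommerville relations. -/
theorem IsHomologySphere.isPalindromic_hPoly {R : Type*} [CommRing R] [IsDomain R]
    {K : SimpComplex V} {d : ℕ} (hK : K.IsHomologySphere R d) : IsPalindromic d K.hPoly := by
  obtain ⟨-, hd, h⟩ := isHomologySphere_iff.1 hK
  subst hd
  refine ⟨natDegree_hPoly_le K, ?_⟩
  -- The Euler relation of the link of σ, written over the faces containing σ and with its sign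
  -- normalised to 1.
  have heuler : ∀ σ ∈ K.faces,
      ∑ τ ∈ K.faces with σ ⊆ τ, (-1 : ℤ[X]) ^ (K.size - #τ) = 1 := by
    intro σ hσ
    have hle : #σ ≤ K.size := card_le_size hσ
    rw [sum_filter_subset_eq_sum_link K σ (fun n => (-1 : ℤ[X]) ^ (K.size - n))]
    have e := congrArg (fun z : ℤ => (-1 : ℤ[X]) ^ (K.size - #σ) * C z)
      (h σ hσ).sum_neg_one_pow_card
    simp only [map_sum, C_pow, C_neg, C_1, mul_sum] at e
    rw [← mul_pow, neg_one_mul, neg_neg, one_pow] at e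
    refine Eq.trans (sum_congr rfl fun B hB => ?_) e
    have hB' := mem_link.1 (show B ∈ K.link σ from hB)
    have hc := card_le_size hB'.2
    rw [card_union_of_disjoint hB'.1] at hc
    rw [show K.size - #σ = (K.size - (#σ + #B)) + #B by omega, pow_add, mul_assoc, ← mul_pow,
      neg_one_mul, neg_neg, one_pow, mul_one]
  rw [reflect_hPoly, hPoly_eq_sum]
  symm
  -- Insert the Euler relation as a factor 1 and exchange the sums. For fixed τ, the binomial
  -- theorem collapses the sum over σ ⊆ τ to (1 - X)^(n - |τ|), and the sign turns this into (X -
  -- 1)^(n - |τ|).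
  calc ∑ σ ∈ K.faces, X ^ #σ * (1 - X : ℤ[X]) ^ (K.size - #σ)
      = ∑ σ ∈ K.faces, ∑ τ ∈ K.faces with σ ⊆ τ,
          (-1 : ℤ[X]) ^ (K.size - #τ) * (X ^ #σ * (1 - X) ^ (K.size - #σ)) := by
        refine sum_congr rfl fun σ hσ => ?_
        rw [← sum_mul, heuler σ hσ, one_mul]
    _ = ∑ τ ∈ K.faces, ∑ σ ∈ τ.powerset,
          (-1 : ℤ[X]) ^ (K.size - #τ) * (X ^ #σ * (1 - X) ^ (K.size - #σ)) := by
        refine sum_comm' fun σ τ => ?_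
        rw [mem_filter, mem_powerset]
        exact ⟨fun h => ⟨h.2.2, h.2.1⟩, fun h => ⟨K.down_closed _ h.2 _ h.1, h.2, h.1⟩⟩
    _ = _ := by
        refine sum_congr rfl fun τ hτ => ?_
        have hle : #τ ≤ K.size := card_le_size hτ
        have hsum : ∑ σ ∈ τ.powerset, (X ^ #σ * (1 - X : ℤ[X]) ^ (K.size - #σ)) =
            (1 - X) ^ (K.size - #τ) := by
          have hp := sum_pow_mul_eq_add_pow (X : ℤ[X]) (1 - X) τ
          rw [add_sub_cancel, one_pow] at hp
          have hp' := congrArg (fun p => (1 - X : ℤ[X]) ^ (K.size - #τ) * p) hp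
          simp only [mul_sum, mul_one] at hp'
          refine Eq.trans (sum_congr rfl fun σ hσ => ?_) hp'
          have := card_le_card (mem_powerset.1 hσ)
          rw [show K.size - #σ = (K.size - #τ) + (#τ - #σ) by omega, pow_add]
          ring
        rw [← mul_sum, hsum, ← mul_pow]
        congr 1
        ring

/-! ### The h-polynomial under stellar subdivision -/

/-- This is h(∂F). Summing X^|A| (1 - X)^(|F| - |A|) over all A ⊆ F gives 1; omitting A = F leaves 1
- X^|F|, which is then divided by 1 - X. -/
theorem sum_ssubsets_eq_geomPoly {F : Finset V} (hF : F.Nonempty) :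
    ∑ A ∈ F.ssubsets, (X ^ #A * (1 - X : ℤ[X]) ^ (#F - 1 - #A)) = geomPoly (#F - 1) := by
  have hpos := card_pos.2 hF
  apply mul_left_cancel₀ X_sub_one_ne_zero'
  rw [X_sub_one_mul_geomPoly, Nat.sub_add_cancel hpos, ← neg_inj, neg_sub, ← neg_mul, neg_sub,
    mul_sum]
  have hp := sum_pow_mul_eq_add_pow (X : ℤ[X]) (1 - X) F
  rw [add_sub_cancel, one_pow, ← sum_erase_add _ _ (mem_powerset_self F), Nat.sub_self, pow_zero,
    mul_one] at hp
  refine Eq.trans (sum_congr rfl fun A hA => ?_) (eq_sub_of_add_eq hp)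
  have := card_lt_card (mem_ssubsets.1 hA)
  rw [show #F - #A = #F - 1 - #A + 1 by omega, pow_succ]
  ring

/-- Faces without v are the faces of K not containing F; those with v are uniquely {v} ∪ A ∪ B with
A ⊊ F and B in the link. -/
theorem sum_stellar_faces {A : Type*} [AddCommMonoid A] {K : SimpComplex V} {F : Finset V} {v : V}
    (hF : F ∈ K) (hv : {v} ∉ K) (w : ℕ → A) :
    ∑ T ∈ (K.stellar F v).faces, w #T = (∑ T ∈ K.faces with ¬ F ⊆ T, w #T) +
      ∑ p ∈ F.ssubsets ×ˢ (K.link F).faces, w (#p.1 + #p.2 + 1) := by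
  have hvF := notMem_of_singleton_notMem hv hF
  rw [← sum_filter_add_sum_filter_not _ (fun T => v ∉ T)]
  congr 1
  · refine sum_congr ?_ fun _ _ => rfl
    ext T
    rw [mem_filter, mem_filter]
    change T ∈ K.stellar F v ∧ _ ↔ T ∈ K ∧ _
    rw [mem_stellar hF hv]
    have : T ∈ K → v ∉ T := notMem_of_singleton_notMem hv
    tauto
  · symm
    have hp {p : Finset V × Finset V} (hp : p ∈ F.ssubsets ×ˢ (K.link F).faces) :
        p.1 ⊂ F ∧ Disjoint F p.2 ∧ F ∪ p.2 ∈ K ∧ v ∉ p.1 ∪ p.2 := by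
      rw [mem_product, mem_ssubsets] at hp
      have h2 := mem_link.1 (show p.2 ∈ K.link F from hp.2)
      refine ⟨hp.1, h2.1, h2.2, fun h => notMem_of_singleton_notMem hv h2.2 ?_⟩
      exact union_subset_union_left hp.1.1 h
    refine sum_nbij' (fun p => insert v (p.1 ∪ p.2)) (fun T => (T ∩ F, T.erase v \ F))
      ?_ ?_ ?_ ?_ ?_
    · intro p h
      obtain ⟨h1, h2, h3, h4⟩ := hp h
      refine mem_filter.2 ⟨(mem_stellar hF hv).2 ⟨fun h => h1.2 ?_, Or.inr
        ⟨mem_insert_self _ _, ?_⟩⟩, not_not.2 (mem_insert_self _ _)⟩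
      · exact h2.left_le_of_le_sup_right ((subset_insert_iff_of_notMem hvF).1 h)
      · rw [erase_insert h4, union_right_comm, union_eq_right.2 h1.1]
        exact h3
    · intro T hT
      rw [mem_filter, not_not] at hT
      have hT' := (mem_stellar hF hv).1 (show T ∈ K.stellar F v from hT.1)
      have hTK : T ∉ K := fun h => notMem_of_singleton_notMem hv h hT.2
      have hTF : T.erase v ∪ F ∈ K := by tauto
      refine mem_product.2 ⟨mem_ssubsets.2 ⟨inter_subset_right, fun h => hT'.1 ?_⟩,
        mem_link.2 ⟨disjoint_sdiff, ?_⟩⟩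
      · exact h.trans inter_subset_left
      · rwa [union_sdiff_self_eq_union, union_comm]
    · intro p h
      obtain ⟨h1, h2, h3, h4⟩ := hp h
      refine Prod.ext ?_ ?_
      · change insert v (p.1 ∪ p.2) ∩ F = p.1
        rw [insert_inter_of_notMem hvF, union_inter_distrib_right, inter_eq_left.2 h1.1,
          disjoint_iff_inter_eq_empty.1 h2.symm, union_empty]
      · change (insert v (p.1 ∪ p.2)).erase v \ F = p.2
        rw [erase_insert h4, union_sdiff_distrib, sdiff_eq_empty_iff_subset.2 h1.1, empty_union,
          sdiff_eq_self_of_disjoint h2.symm]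
    · intro T hT
      rw [mem_filter, not_not] at hT
      change insert v (T ∩ F ∪ T.erase v \ F) = T
      have : T ∩ F = T.erase v ∩ F := by
        rw [erase_inter, erase_eq_of_notMem fun h => hvF (mem_inter.1 h).2]
      rw [this, union_comm, sdiff_union_inter, insert_erase hT.2]
    · intro p h
      obtain ⟨h1, h2, h3, h4⟩ := hp h
      rw [card_insert_of_notMem h4, card_union_of_disjoint (h2.mono_left h1.1)]

/-- The faces containing F give the term on the left, the faces containing v the last term on the
right. The size hypotheses align the exponents of 1 - X. -/
theorem hPoly_stellar_add {K : SimpComplex V} {F : Finset V} {v : V} (hF : F ∈ K)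
    (hF0 : F.Nonempty) (hv : {v} ∉ K) (hs : (K.stellar F v).size = K.size)
    (hl : (K.link F).size = K.size - #F) :
    (K.stellar F v).hPoly + X ^ #F * (K.link F).hPoly =
      K.hPoly + X * geomPoly (#F - 1) * (K.link F).hPoly := by
  have hpos := card_pos.2 hF0
  have hFd : #F ≤ K.size := card_le_size hF
  have e1 : X ^ #F * (K.link F).hPoly =
      ∑ T ∈ K.faces with F ⊆ T, (X ^ #T * (1 - X : ℤ[X]) ^ (K.size - #T)) := by
    rw [sum_filter_subset_eq_sum_link K F fun n => X ^ n * (1 - X : ℤ[X]) ^ (K.size - n),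
      hPoly_eq_sum, hl, mul_sum]
    refine sum_congr rfl fun B _ => ?_
    rw [pow_add, Nat.sub_sub, mul_assoc]
  have e2 : X * geomPoly (#F - 1) * (K.link F).hPoly =
      ∑ p ∈ F.ssubsets ×ˢ (K.link F).faces,
        (X ^ (#p.1 + #p.2 + 1) * (1 - X : ℤ[X]) ^ (K.size - (#p.1 + #p.2 + 1))) := by
    rw [← sum_ssubsets_eq_geomPoly hF0, hPoly_eq_sum, hl, mul_assoc, sum_mul_sum, sum_product,
      mul_sum]
    refine sum_congr rfl fun A hA => ?_
    rw [mul_sum]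
    refine sum_congr rfl fun B hB => ?_
    have hA' := card_lt_card (mem_ssubsets.1 hA)
    have hB' : #B ≤ K.size - #F := hl ▸ card_le_size (show B ∈ K.link F from hB)
    rw [show K.size - (#A + #B + 1) = (#F - 1 - #A) + (K.size - #F - #B) by omega, pow_add]
    ring
  rw [e1, e2, hPoly_eq_sum, hPoly_eq_sum, hs,
    sum_stellar_faces hF hv fun n => X ^ n * (1 - X : ℤ[X]) ^ (K.size - n),
    ← sum_filter_add_sum_filter_not K.faces (fun T => F ⊆ T)]
  ring

end HPoly

end SimpComplex
end

/-! ### The main theorem -/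

theorem mainTheorem8 {V : Type*} [LinearOrder V] (R : Type*) [CommRing R] [IsDomain R]
    (i d : ℕ) (hi : 1 ≤ i) (hd : 1 ≤ d)
    (Δ : SimpComplex V) (hΔ : Δ.IsHS R i d)
    (F : Finset V) (hF : F ∈ Δ) (hF0 : F.Nonempty) (hFi : F.card ≤ i + 1)
    (v : V) (hv : {v} ∉ Δ) :
    (Δ.link F).IsHS R i (d - F.card) ∧
    (Δ.stellar F v).IsHS R i d ∧
    InGSpan i d Δ.hPoly ∧
    InGSpan i (d - F.card) (Δ.link F).hPoly ∧
    InGSpan i d (Δ.stellar F v).hPoly ∧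
    (0 ≤ gVector i d Δ.hPoly →
      0 ≤ gVector i (d - F.card) (Δ.link F).hPoly →
      0 ≤ gVector i d (Δ.stellar F v).hPoly) := by
  obtain ⟨hS, hM⟩ := hΔ
  have hL := hS.link hF
  have hT := hS.stellar hF hF0 hv
  have gS := inGSpan_of_isPalindromic hi d _ hS.isPalindromic_hPoly
  have gL := inGSpan_of_isPalindromic hi _ _ hL.isPalindromic_hPoly
  have gT := inGSpan_of_isPalindromic hi d _ hT.isPalindromic_hPoly
  refine ⟨⟨hL, fun M hM' => SimpComplex.card_le_of_isMissingFace_link hM hM'⟩,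
    ⟨hT, fun M hM' => SimpComplex.card_le_of_isMissingFace_stellar hM hF hFi hv hM'⟩,
    gS, gL, gT, ?_⟩
  rw [← inGCone_iff gS, ← inGCone_iff gL, ← inGCone_iff gT]
  intro cS cL
  have hsize := hS.2.1
  have hFd : #F ≤ d := hsize ▸ SimpComplex.card_le_size hF
  have hpos := card_pos.2 hF0
  have key := SimpComplex.hPoly_stellar_add hF hF0 hv (hT.2.1.trans hsize.symm)
    (hL.2.1.trans (by rw [hsize]))
  -- For |F| = 1 the subdivision only replaces a vertex by v, and h is unchanged.
  rcases Nat.eq_or_lt_of_le hpos with h1 | h1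
  · have e : X * geomPoly (#F - 1) = (X ^ #F : ℤ[X]) := by
      rw [← h1]
      simp [geomPoly]
    rw [e] at key
    rwa [add_right_cancel key]
  -- With a = |F| - 2, the top term of X * `geomPoly (a + 1)` is X^|F| and cancels the contribution
  -- of the faces containing F.
  · obtain ⟨a, ha⟩ : ∃ a, #F = a + 2 := ⟨#F - 2, by omega⟩
    have e : X * geomPoly (#F - 1) = X * geomPoly a + (X ^ #F : ℤ[X]) := by
      rw [ha, show a + 2 - 1 = a + 1 from rfl, geomPoly, sum_range_succ, ← geomPoly]
      ring
    have e' : (Δ.stellar F v).hPoly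
        = Δ.hPoly + X ^ 1 * (geomPoly a * (Δ.link F).hPoly) := by
      rw [e] at key
      linear_combination key
    rw [e']
    -- The degrees add up: (d - |F|) + a + 2 = d, where the factor X accounts for 2.
    exact cS.add (InGCone.X_pow_mul (e := d - #F + a) (by omega)
      (cL.geomPoly_mul hi (by omega)))
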